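/- Let $q\ge 2$ be an integer, let $T=T_{q+1}$ be the homogeneous tree of valency $q+1$ with a distinguished vertex $v_0$, and let $\partial T$ be its space of ends. Let $\Gamma$ be the dynamic graph of $(T,v_0)$: the vertices of its $n$th level are the vertices of $T$ that can be joined to $v_0$ by a walk of length $n$, and two vertices of $\Gamma$ are adjacent if and only if they lie at adjacent levels and are joined by an edge in $T$; $\pi$ denotes the projection of $\Gamma$ onto $T$, and $\varnothing$ the unique vertex of level $0$. A probability measure on the space of infinite paths of $\Gamma$ starting at $\varnothing$ is called central if for every vertex $v$ of $\Gamma$ the conditional measure on the finite paths from $\varnothing$ to $v$ is uniform; a central measure is called ergodic if it is an extreme point of the convex set of central measures. For $\omega\in\partial T$, an edge of $\Gamma$ from $v$ to a vertex $w$ of the next level is called $\omega$-directed if $\pi(w)$ lies on the geodesic ray from $\pi(v)$ to $\omega$. For $r\in[0,1]$, let $\lambda_{\omega,r}$ be the Markov measure on the path space whose transition probabilities are $r$ on all $\omega$-directed edges and $\frac{1-r}{q}$ on all other edges. Every ergodic central measure $\nu$ is equal to $\lambda_{\omega,r}$ for some $\omega\in\partial T$ and $r\in[0,1]$. In other words,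 the transition probabilities of $\nu$ (from vertices that are visited with positive probability) coincide, and are equal to $r$, on all $\omega$-directed edges, and coincide, and are equal to $\frac{1-r}{q}$, on all other edges; in particular, $\nu$ is time-homogeneous, i.e. these transition probabilities depend only on the projections of the vertices to $T$. Moreover, if $\nu$ is degenerate, i.e. some finite path starting at $\varnothing$ has $\nu$-measure $0$, then $r=1$, and $\nu=\lambda_{\omega,1}$ is the Dirac measure at the path that projects to the geodesic ray from $v_0$ to $\omega$. -/

import Mathlib

open Filter MeasureTheory ProbabilityTheory
open scoped NNReal ENNReal

/-- A vertex of the dynamic graph of `(G, v₀)`: a vertex `proj` of `G` placed at level `level`,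
where `proj` can be joined to `v₀` by a walk of length `level`. -/
@[ext]
structure DynVertex {V : Type*} (G : SimpleGraph V) (v₀ : V) where
  /-- the level -/
  level : ℕ
  /-- the projection to the underlying graph -/
  proj : V
  reachable : ∃ p : G.Walk v₀ proj, p.length = level

namespace DynamicGraph

variable {V : Type*} (G : SimpleGraph V) (v₀ : V)

/-- The dynamic graph of `(G, v₀)`: two vertices are adjacent if and only if they lie at adjacent
levels and their projections are joined by an edge of `G`. -/
def dynamicGraph : SimpleGraph (DynVertex G v₀) where
  Adj a b := (b.level = a.level + 1 ∨ a.level = b.level + 1) ∧ G.Adj a.proj b.proj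
  symm := ⟨fun _ _ h => ⟨h.1.symm, h.2.symm⟩⟩
  loopless := ⟨fun _ h => G.loopless.irrefl _ h.2⟩

/-- The unique vertex of level zero. -/
def root : DynVertex G v₀ := ⟨0, v₀, SimpleGraph.Walk.nil, rfl⟩

variable {G v₀}

/-- `Succ a b`: there is an edge from `a` to `b` and `b` lies one level further than `a`. -/
def Succ (a b : DynVertex G v₀) : Prop :=
  (dynamicGraph G v₀).Adj a b ∧ b.level = a.level + 1

variable (G v₀)

/-- The space of infinite paths of the dynamic graph, starting at the root. -/
def Paths : Type _ :=
  {w : ℕ → DynVertex G v₀ // w 0 = root G v₀ ∧ ∀ n, Succ (w n) (w (n + 1))}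

/-- The levels are discrete. -/
instance : MeasurableSpace (DynVertex G v₀) := ⊤

/-- The sigma-algebra generated by the coordinates. For a countable vertex set it is the Borel
sigma-algebra of the product topology. -/
instance : MeasurableSpace (Paths G v₀) :=
  inferInstanceAs (MeasurableSpace
    {w : ℕ → DynVertex G v₀ // w 0 = root G v₀ ∧ ∀ n, Succ (w n) (w (n + 1))})

variable {G v₀}

/-- Finite paths from the root to `v`. -/
structure FinPath (v : DynVertex G v₀) where
  /-- the successive vertices -/
  vert : Fin (v.level + 1) → DynVertex G v₀
  start : vert 0 = root G v₀
  step : ∀ i : Fin v.level, Succ (vert i.castSucc) (vert i.succ)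
  finish : vert (Fin.last v.level) = v

/-- The set of infinite paths that start with the finite path `P`. -/
def cylinder {v : DynVertex G v₀} (P : FinPath v) : Set (Paths G v₀) :=
  {w | ∀ i : Fin (v.level + 1), w.1 i = P.vert i}

/-- The set of infinite paths that pass through `v`. -/
def through (v : DynVertex G v₀) : Set (Paths G v₀) := {w | w.1 v.level = v}

/-- A measure is central if for every vertex `v` the conditional measure on the (finite) set of
finite paths from the root to `v` is uniform. (If `through v` is a null set, both sides vanish.) -/
def IsCentral (ν : Measure (Paths G v₀)) : Prop :=
  ∀ (v : DynVertex G v₀) (P P' : FinPath v),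
    ProbabilityTheory.cond ν (through v) (cylinder P) =
      ProbabilityTheory.cond ν (through v) (cylinder P')

variable (G v₀)

/-- The convex set of central probability measures on the path space. -/
def centralMeasures : Set (Measure (Paths G v₀)) := {ν | IsProbabilityMeasure ν ∧ IsCentral ν}

variable {G v₀}

/-- An ergodic central measure is an extreme point of the set of central probability measures. -/
def IsErgodicCentral (ν : Measure (Paths G v₀)) : Prop :=
  ν ∈ Set.extremePoints ℝ≥0 (centralMeasures G v₀)

/-- A measure is nondegenerate if every finite path starting at the root has positive measure. -/
def IsNondegenerate (ν : Measure (Paths G v₀)) : Prop :=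
  ∀ (v : DynVertex G v₀) (P : FinPath v), ν (cylinder P) ≠ 0

/-- The transition probability `ν (w passes through b | w passes through a)`; it is meaningful
if `through a` has positive measure. -/
noncomputable def transProb (ν : Measure (Paths G v₀)) (a b : DynVertex G v₀) : ℝ :=
  (ProbabilityTheory.cond ν (through a)).real (through b)

/-- Time-homogeneity: the transition probabilities from accessible vertices depend only on the
projections to `G`, not on the level. -/
def IsTimeHomogeneous (ν : Measure (Paths G v₀)) : Prop :=
  ∀ a b a' b' : DynVertex G v₀, Succ a b → Succ a' b' → a.proj = a'.proj → b.proj = b'.proj →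
    ν (through a) ≠ 0 → ν (through a') ≠ 0 → transProb ν a b = transProb ν a' b'

/-- `ν` is the Markov measure (the law of the Markov chain started at the root) with transition
probabilities `p` on the edges. -/
def IsMarkovMeasure (ν : Measure (Paths G v₀)) (p : DynVertex G v₀ → DynVertex G v₀ → ℝ) : Prop :=
  IsProbabilityMeasure ν ∧
    ∀ (v : DynVertex G v₀) (P : FinPath v),
      ν.real (cylinder P) = ∏ i : Fin v.level, p (P.vert i.castSucc) (P.vert i.succ)

/-- A geodesic ray in `G`. -/
def IsGeodesicRay (γ : ℕ → V) : Prop :=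
  ∀ m k : ℕ, G.Reachable (γ m) (γ (m + k)) ∧ G.dist (γ m) (γ (m + k)) = k

/-- The sequence `x` converges to the end `ω`: for every finite set `K` of vertices it eventually
stays in the connected component of the complement of `K` that `ω` selects. -/
def TendsToEnd (ω : G.end) (x : ℕ → V) : Prop :=
  ∀ K : Finset V, ∀ᶠ n in atTop, x n ∈ (ω.1 (Opposite.op K) : G.ComponentCompl K).supp

/-- `y` lies on the geodesic ray from `x` to the end `ω`. -/
def LiesBetween (ω : G.end) (x y : V) : Prop :=
  ∃ γ : ℕ → V, IsGeodesicRay (G := G) γ ∧ γ 0 = x ∧ TendsToEnd ω γ ∧ y ∈ Set.range γ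

/-- The edge from `a` to `b` is `ω`-directed if the projection of `b` lies between the projection
of `a` and `ω`. -/
def IsDirected (ω : G.end) (a b : DynVertex G v₀) : Prop :=
  Succ a b ∧ LiesBetween ω a.proj b.proj

open Classical in
/-- The transition probabilities of `λ_{ω,r}` on the dynamic graph of the `(q+1)`-regular tree:
`r` on the `ω`-directed edges and `(1 - r) / q` on all other edges. -/
noncomputable def lambdaProb (q : ℕ) (ω : G.end) (r : ℝ) (a b : DynVertex G v₀) : ℝ :=
  if IsDirected ω a b then r else (1 - r) / q

/-- `ν` is the measure `λ_{ω,r}`, i.e. the Markov measure with transition probabilities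
`lambdaProb q ω r`. -/
def IsLambda (q : ℕ) (ω : G.end) (r : ℝ) (ν : Measure (Paths G v₀)) : Prop :=
  IsMarkovMeasure ν (lambdaProb q ω r)

end DynamicGraph

/-! ### Distances in trees and the two sides of an edge. -/

namespace SimpleGraph

variable {V : Type*} {G : SimpleGraph V}

/-! A central measure is determined by the numbers h(n, x), the measure of any single path of length
n from the root to x (`cylinderValue`). Splitting a cylinder by the next vertex shows that h is
harmonic on the dynamic graph. Ergodicity makes h minimal: if g is harmonic and 0 ≤ g ≤ h, the
ratios g/h along random paths form a bounded martingale, whose limit is a density splitting the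
measure into two central ones; extremality forces g to be a multiple of h
(`IsErgodicCentral.eq_mul`).

Apply this to g(n, x) = h(n + 2, x), which is at most h(n, x) because one can step out and back.
Thus h(n + 2, x) = c h(n, x) with c = h(2, v₀).

If c > 0, put t = 1/√c. Since levels over x all have the same parity, f(x) = tⁿ h(n, x) depends on x
only; it is a minimal positive eigenfunction of the adjacency operator with eigenvalue t. With s the
smaller root of t = 1/s + q s, a Harnack inequality gives f(y) ≥ s f(x) on every edge. Cutting f
along an edge and replacing it by exponential pieces gives a smaller eigenfunction, so minimality
forces the ratio on each edge to be s or 1/s (`IsEigen.eq_or_eq_of_minimal`). Then each vertex has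
exactly one neighbour where f grows; following these leads to a single end ω, and the transition
probabilities are f(y) / (t f(x)), so r = 1/(s t).

If c = 0, only vertices whose level equals their distance from v₀ are visited. These are reached by
a unique path, so centrality is vacuous for all measures absolutely continuous with respect to ν,
and extremality yields a zero-one law: ν is a Dirac measure on a geodesic ray. -/

theorem IsTree.exists_adj_dist_add_one (hT : G.IsTree) {u x : V} (hne : u ≠ x) :
    ∃ z, G.Adj u z ∧ G.dist u x = G.dist z x + 1 := by
  obtain ⟨p, hp⟩ := hT.connected.exists_walk_length_eq_dist u x
  cases p with
  | nil => exact absurd rfl hne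
  | cons h p' =>
    rename_i z
    refine ⟨z, h, ?_⟩
    have h1 := SimpleGraph.dist_le p'
    have h2 := hT.dist_eq_dist_add_one_of_adj x h
    simp only [Walk.length_cons] at hp
    rw [G.dist_comm (u := x) (v := u), G.dist_comm (u := x) (v := z)] at h2
    omega

/-- Prepending the edge to a geodesic from the neighbour gives a path from `u` to `x`, and a tree
has only one. -/
theorem IsTree.eq_of_adj_of_dist_add_one (hT : G.IsTree) {u x z z' : V} (hz : G.Adj u z)
    (hz' : G.Adj u z') (h : G.dist u x = G.dist z x + 1) (h' : G.dist u x = G.dist z' x + 1) :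
    z = z' := by
  have key : ∀ {z : V}, G.Adj u z → G.dist u x = G.dist z x + 1 →
      ∃ p : G.Walk u x, p.IsPath ∧ p.snd = z := by
    intro z hz h
    obtain ⟨p, hp⟩ := hT.connected.exists_walk_length_eq_dist z x
    refine ⟨Walk.cons hz p, Walk.isPath_of_length_eq_dist _ ?_, by simp⟩
    simp [hp, h]
  obtain ⟨p, hp, hpz⟩ := key hz h
  obtain ⟨p', hp', hpz'⟩ := key hz' h'
  rw [← hpz, ← hpz', (hT.existsUnique_path u x).unique hp hp']

theorem IsTree.dist_adj_cases (hT : G.IsTree) {u z : V} (x : V) (hz : G.Adj u z) :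
    G.dist u x = G.dist z x + 1 ∨ G.dist z x = G.dist u x + 1 := by
  have h2 := hT.dist_eq_dist_add_one_of_adj x hz
  rwa [G.dist_comm (u := x) (v := u), G.dist_comm (u := x) (v := z)] at h2

/-- A neighbour of a vertex on the `x`-side of the edge from `x` to `y` lies on the same side,
unless the edge is crossed. -/
theorem IsTree.side_of_adj (hT : G.IsTree) {x y u z : V} (hxy : G.Adj x y) (huz : G.Adj u z)
    (hu : G.dist u y = G.dist u x + 1) (hne : u ≠ x ∨ z ≠ y) :
    G.dist z y = G.dist z x + 1 := by
  have hside : ∀ w, G.dist w x = G.dist w y + 1 ∨ G.dist w y = G.dist w x + 1 :=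
    fun w => hT.dist_eq_dist_add_one_of_adj w hxy
  rcases hside z with hz | hz
  · exfalso
    have hux := hT.dist_adj_cases x huz
    have huy := hT.dist_adj_cases y huz
    by_cases hu0 : u = x
    · subst hu0
      simp only [SimpleGraph.dist_self] at *
      have : G.dist z y = 0 := by omega
      rcases hne with h | h
      · exact h rfl
      · exact h ((hT.connected.dist_eq_zero_iff).1 this)
    -- If `z` were on the other side, it would be the neighbour of `u` towards `y`. So is the
    -- neighbour `z'` towards `x`; hence they coincide, and the distances to `x` disagree.
    · obtain ⟨z', hz', hd⟩ := hT.exists_adj_dist_add_one hu0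
      have h1 := hside z'
      have h2 := hT.dist_adj_cases y hz'
      have : z = z' := hT.eq_of_adj_of_dist_add_one (x := y) huz hz' (by omega) (by omega)
      subst this
      omega
  · exact hz

theorem IsTree.walk_length_mod_two (hT : G.IsTree) {x y : V} (p : G.Walk x y) :
    p.length % 2 = G.dist x y % 2 := by
  induction p with
  | nil => simp
  | cons h p ih =>
    rename_i u v w
    have := hT.dist_adj_cases w h
    simp only [Walk.length_cons]
    omega

/-- One neighbour of `u` is closer to `x` and the other `q` are farther away, which contributes the
factors `1 / s` and `q * s`. -/
theorem IsTree.sum_pow_dist [G.LocallyFinite] (hT : G.IsTree) {q : ℕ}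
    (hreg : G.IsRegularOfDegree (q + 1)) {u x : V} (hne : u ≠ x) {s t : ℝ} (hs : s ≠ 0)
    (ht : t = 1 / s + q * s) :
    ∑ z ∈ G.neighborFinset u, s ^ G.dist z x = t * s ^ G.dist u x := by
  classical
  obtain ⟨z, hz, hd⟩ := hT.exists_adj_dist_add_one hne
  have hmem : z ∈ G.neighborFinset u := by simpa using hz
  rw [← Finset.add_sum_erase _ _ hmem]
  have h1 : ∀ w ∈ (G.neighborFinset u).erase z, s ^ G.dist w x = s ^ (G.dist u x + 1) := by
    intro w hw
    rw [Finset.mem_erase, mem_neighborFinset] at hw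
    rcases hT.dist_adj_cases x hw.2 with h | h
    · exact absurd (hT.eq_of_adj_of_dist_add_one hw.2 hz h hd) hw.1
    · rw [h]
  rw [Finset.sum_congr rfl h1, Finset.sum_const, Finset.card_erase_of_mem hmem,
    card_neighborFinset_eq_degree, hreg u, hd, ht]
  simp only [Nat.add_sub_cancel, nsmul_eq_mul]
  field_simp
  ring

end SimpleGraph

/-! ### Geodesic rays and ends of a tree. -/

namespace DynamicGraph

open SimpleGraph

variable {V : Type*} {G : SimpleGraph V}

theorem IsGeodesicRay.dist_eq {γ : ℕ → V} (hγ : IsGeodesicRay (G := G) γ) {m n : ℕ}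
    (h : m ≤ n) : G.dist (γ m) (γ n) = n - m := by
  obtain ⟨k, rfl⟩ := Nat.exists_eq_add_of_le h
  rw [(hγ m k).2]; omega

theorem IsGeodesicRay.injective {γ : ℕ → V} (hγ : IsGeodesicRay (G := G) γ) :
    Function.Injective γ := by
  intro m n hmn
  wlog h : m ≤ n generalizing m n
  · exact (this hmn.symm (by omega)).symm
  have := hγ.dist_eq h
  rw [hmn, SimpleGraph.dist_self] at this
  omega

theorem IsGeodesicRay.adj {γ : ℕ → V} (hγ : IsGeodesicRay (G := G) γ) (n : ℕ) :
    G.Adj (γ n) (γ (n + 1)) :=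
  SimpleGraph.dist_eq_one_iff_adj.1 (hγ n 1).2

theorem TendsToEnd.of_shift {ω : G.end} {γ : ℕ → V} (h : TendsToEnd ω (fun n => γ (n + 1))) :
    TendsToEnd ω γ :=
  fun K => by
    rw [← Filter.map_add_atTop_eq_nat 1]
    exact Filter.eventually_map.2 (h K)

theorem TendsToEnd.shift {ω : G.end} {γ : ℕ → V} (h : TendsToEnd ω γ) :
    TendsToEnd ω (fun n => γ (n + 1)) :=
  fun K => (tendsto_add_atTop_nat 1).eventually (h K)

/-- A ray is injective, so it leaves the finite set `K` for good; from then on consecutive vertices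
are adjacent outside `K`. -/
theorem IsGeodesicRay.exists_component {γ : ℕ → V} (hγ : IsGeodesicRay (G := G) γ)
    (K : Finset V) : ∃ C : G.ComponentCompl K, ∀ᶠ n in atTop, γ n ∈ C.supp := by
  have hfin : {n | γ n ∈ K}.Finite := K.finite_toSet.preimage hγ.injective.injOn
  obtain ⟨N, hN⟩ := hfin.bddAbove
  have hout : ∀ n, N + 1 ≤ n → γ n ∉ (K : Set V) := by
    intro n hn h
    have := hN (show n ∈ {n | γ n ∈ K} from h)
    omega
  refine ⟨G.componentComplMk (hout (N + 1) le_rfl), ?_⟩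
  filter_upwards [eventually_ge_atTop (N + 1)] with n hn
  induction n, hn using Nat.le_induction with
  | base => exact G.componentComplMk_mem _
  | succ n hn ih =>
    exact ComponentCompl.mem_of_adj (γ n) (γ (n + 1)) ih (hout _ (by omega)) (hγ.adj n)

theorem IsGeodesicRay.exists_end {γ : ℕ → V} (hγ : IsGeodesicRay (G := G) γ) :
    ∃ ω : G.end, TendsToEnd ω γ := by
  choose C hC using hγ.exists_component
  refine ⟨⟨fun K => C K.unop, ?_⟩, fun K => hC K⟩
  intro K L f
  have hsub : ((L.unop : Finset V) : Set V) ⊆ K.unop := CategoryTheory.le_of_op_hom f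
  obtain ⟨n, hn, hn'⟩ := ((hC K.unop).and (hC L.unop)).exists
  refine (ComponentCompl.hom_eq_iff_not_disjoint (C K.unop) hsub (C L.unop)).2 ?_
  exact Set.not_disjoint_iff.2 ⟨γ n, hn, hn'⟩

/-- The two sides of the edge are joined by that edge alone, and a walk avoiding `x` cannot use it.
-/
theorem side_eq_of_componentCompl (hT : G.IsTree) {x z u u' : V} (hz : G.Adj x z)
    {C : G.ComponentCompl (({x} : Finset V) : Set V)} (hu : u ∈ C.supp) (hu' : u' ∈ C.supp)
    (h : G.dist u x = G.dist u z + 1) : G.dist u' x = G.dist u' z + 1 := by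
  obtain ⟨hux, hC⟩ := hu
  obtain ⟨hux', hC'⟩ := hu'
  have hr := SimpleGraph.ConnectedComponent.exact (hC.trans hC'.symm)
  obtain ⟨p⟩ := hr
  have key : ∀ (a b : ↥((({x} : Finset V) : Set V)ᶜ)) (_ : (G.induce _).Walk a b),
      G.dist a.1 x = G.dist a.1 z + 1 → G.dist b.1 x = G.dist b.1 z + 1 := by
    intro a b p
    induction p with
    | nil => exact id
    | cons hadj p ih =>
      rename_i a b c
      intro ha
      refine ih (hT.side_of_adj hz.symm hadj ha (Or.inr ?_))
      simpa using b.2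
  exact key _ _ p h

/-- The second vertex of the geodesic ray from a vertex of a tree to an end is determined. -/
theorem IsGeodesicRay.eq_of_tendsToEnd (hT : G.IsTree) {ω : G.end} {γ γ' : ℕ → V}
    (hγ : IsGeodesicRay (G := G) γ) (hγ' : IsGeodesicRay (G := G) γ') (h0 : γ 0 = γ' 0)
    (hω : TendsToEnd ω γ) (hω' : TendsToEnd ω γ') : γ 1 = γ' 1 := by
  obtain ⟨n, ⟨hn, hn'⟩, hn1⟩ :=
    (((hω {γ 0}).and (hω' {γ 0})).and (eventually_ge_atTop 1)).exists
  have h1 : G.dist (γ n) (γ 0) = G.dist (γ n) (γ 1) + 1 := by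
    rw [SimpleGraph.dist_comm, hγ.dist_eq (Nat.zero_le n), SimpleGraph.dist_comm,
      hγ.dist_eq hn1]
    omega
  have h2 : G.dist (γ' n) (γ 0) = G.dist (γ' n) (γ' 1) + 1 := by
    rw [h0, SimpleGraph.dist_comm, hγ'.dist_eq (Nat.zero_le n), SimpleGraph.dist_comm,
      hγ'.dist_eq hn1]
    omega
  -- Both late points lie in the component of the complement of the starting vertex selected by `ω`,
  -- so `γ 1` is also the step towards `γ' n`.
  have h3 := side_eq_of_componentCompl hT (hγ.adj 0) hn hn' h1
  refine hT.eq_of_adj_of_dist_add_one (u := γ 0) (x := γ' n) (hγ.adj 0) (h0 ▸ hγ'.adj 0) ?_ ?_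
  · simpa only [SimpleGraph.dist_comm] using h3
  · simpa only [SimpleGraph.dist_comm] using h2

theorem liesBetween_iff_of_adj (hT : G.IsTree) {ω : G.end} {γ : ℕ → V}
    (hγ : IsGeodesicRay (G := G) γ) (hω : TendsToEnd ω γ) {y : V} (hy : G.Adj (γ 0) y) :
    LiesBetween ω (γ 0) y ↔ y = γ 1 := by
  constructor
  · rintro ⟨γ', hγ', h0, hω', n, rfl⟩
    have h1 := hγ'.dist_eq (Nat.zero_le n)
    rw [h0, SimpleGraph.dist_eq_one_iff_adj.2 hy] at h1
    obtain rfl : n = 1 := by omega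
    exact hγ'.eq_of_tendsToEnd hT hγ h0 hω' hω
  · rintro rfl
    exact ⟨γ, hγ, rfl, hω, 1, rfl⟩

end DynamicGraph

/-! ### Cylinders of the path space and the harmonic function of a central measure. -/

namespace DynamicGraph

open SimpleGraph

variable {V : Type*} {G : SimpleGraph V} {v₀ : V}

section Reach

variable (G v₀) in
/-- The vertex `x` occurs at level `n` of the dynamic graph. -/
abbrev Reach (n : ℕ) (x : V) : Prop := ∃ p : G.Walk v₀ x, p.length = n

theorem Reach.zero : Reach G v₀ 0 v₀ := ⟨Walk.nil, rfl⟩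

theorem Reach.eq_of_zero {x : V} (h : Reach G v₀ 0 x) : x = v₀ := by
  obtain ⟨p, hp⟩ := h
  exact (Walk.eq_of_length_eq_zero hp).symm

theorem Reach.succ {n : ℕ} {x y : V} (h : Reach G v₀ n x) (hxy : G.Adj x y) :
    Reach G v₀ (n + 1) y := by
  obtain ⟨p, hp⟩ := h
  exact ⟨p.concat hxy, by simp [hp]⟩

theorem Reach.exists_of_succ {n : ℕ} {y : V} (h : Reach G v₀ (n + 1) y) :
    ∃ x, Reach G v₀ n x ∧ G.Adj x y := by
  obtain ⟨p, hp⟩ := h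
  have hp' := p.length_reverse
  generalize p.reverse = r at hp'
  cases r with
  | nil => simp at hp'; omega
  | cons hadj r =>
    rename_i z
    refine ⟨z, ⟨r.reverse, ?_⟩, hadj.symm⟩
    simp only [Walk.length_cons] at hp'
    rw [Walk.length_reverse]
    omega

theorem Reach.add_two {n : ℕ} {x y : V} (h : Reach G v₀ n x) (hxy : G.Adj x y) :
    Reach G v₀ (n + 2) x := (h.succ hxy).succ hxy.symm

theorem finite_reach [G.LocallyFinite] (n : ℕ) : {x | Reach G v₀ n x}.Finite := by
  induction n with
  | zero => exact (Set.finite_singleton v₀).subset fun x hx => hx.eq_of_zero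
  | succ n ih =>
    refine (ih.biUnion fun x _ => (G.neighborSet x).toFinite).subset fun y hy => ?_
    obtain ⟨x, hx, hxy⟩ := Reach.exists_of_succ hy
    exact Set.mem_biUnion hx hxy

theorem countable_dynVertex [G.LocallyFinite] : Countable (DynVertex G v₀) := by
  have : ∀ n, Countable {x // Reach G v₀ n x} := fun n => (finite_reach n).countable.to_subtype
  exact Function.Injective.countable
    (f := fun a : DynVertex G v₀ => (⟨a.level, a.proj, a.reachable⟩ : Σ n, {x // Reach G v₀ n x}))
    (by
      rintro ⟨n, x, h⟩ ⟨m, y, h'⟩ he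
      simp only [Sigma.mk.injEq] at he
      obtain ⟨rfl, he⟩ := he
      exact DynVertex.ext rfl (congrArg Subtype.val (eq_of_heq he)))

end Reach

theorem Succ.level {a b : DynVertex G v₀} (h : Succ a b) : b.level = a.level + 1 := h.2

theorem Succ.adj {a b : DynVertex G v₀} (h : Succ a b) : G.Adj a.proj b.proj := h.1.2

/-- The vertex of the next level that is reached along an edge. -/
abbrev next (a : DynVertex G v₀) {y : V} (h : G.Adj a.proj y) : DynVertex G v₀ :=
  ⟨a.level + 1, y, Reach.succ a.reachable h⟩

theorem succ_next (a : DynVertex G v₀) {y : V} (h : G.Adj a.proj y) : Succ a (next a h) :=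
  ⟨⟨Or.inl rfl, h⟩, rfl⟩

theorem Succ.eq_next {a b : DynVertex G v₀} (h : Succ a b) : b = next a h.adj :=
  DynVertex.ext h.level rfl

theorem level_path (w : Paths G v₀) (n : ℕ) : (w.1 n).level = n := by
  induction n with
  | zero => rw [w.2.1]; rfl
  | succ n ih => rw [(w.2.2 n).level, ih]

theorem adj_path (w : Paths G v₀) (n : ℕ) : G.Adj (w.1 n).proj (w.1 (n + 1)).proj :=
  (w.2.2 n).adj

theorem reach_path (w : Paths G v₀) (n : ℕ) : Reach G v₀ n (w.1 n).proj := by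
  have := (w.1 n).reachable
  rwa [level_path] at this

theorem dynVertex_eq_iff {a : DynVertex G v₀} (w : Paths G v₀) :
    w.1 a.level = a ↔ (w.1 a.level).proj = a.proj :=
  ⟨fun h => by rw [h], fun h => DynVertex.ext (level_path w _) h⟩

namespace FinPath

theorem level_vert {v : DynVertex G v₀} (P : FinPath v) (i : Fin (v.level + 1)) :
    (P.vert i).level = i := by
  induction i using Fin.induction with
  | zero => rw [P.start]; rfl
  | succ i ih => rw [(P.step i).level, ih]; simp

/-- The extension of a finite path by an edge. -/
def snoc {a : DynVertex G v₀} (P : FinPath a) {y : V} (h : G.Adj a.proj y) :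
    FinPath (next a h) where
  vert := Fin.snoc (α := fun _ => DynVertex G v₀) P.vert (next a h)
  start := by
    rw [← Fin.castSucc_zero, Fin.snoc_castSucc, P.start]
  step i := by
    induction i using Fin.lastCases with
    | last =>
      rw [Fin.snoc_castSucc, P.finish, Fin.succ_last, Fin.snoc_last]
      exact succ_next a h
    | cast i =>
      rw [Fin.snoc_castSucc, Fin.succ_castSucc, Fin.snoc_castSucc]
      exact P.step i
  finish := Fin.snoc_last _ _

/-- The trivial path. -/
def nil : FinPath (root G v₀) where
  vert _ := root G v₀
  start := rfl
  step i := i.elim0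
  finish := rfl

/-- The beginning of an infinite path. -/
def ofPath (w : Paths G v₀) (n : ℕ) : FinPath (w.1 n) where
  vert i := w.1 i
  start := w.2.1
  step i := w.2.2 i
  finish := by simp [level_path]

theorem nonempty_mk (n : ℕ) (x : V) (h : Reach G v₀ n x) :
    Nonempty (FinPath (⟨n, x, h⟩ : DynVertex G v₀)) := by
  induction n generalizing x with
  | zero =>
    obtain rfl := h.eq_of_zero
    exact ⟨nil⟩
  | succ n ih =>
    obtain ⟨y, hy, hyx⟩ := h.exists_of_succ
    obtain ⟨P⟩ := ih y hy
    exact ⟨P.snoc hyx⟩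

end FinPath

theorem mem_cylinder_level {v : DynVertex G v₀} {P : FinPath v} {w : Paths G v₀}
    (h : w ∈ cylinder P) : w.1 v.level = v := by
  have := h (Fin.last _)
  rwa [P.finish] at this

theorem cylinder_snoc {a : DynVertex G v₀} (P : FinPath a) {y : V} (h : G.Adj a.proj y) :
    cylinder (P.snoc h) = cylinder P ∩ {w | (w.1 (a.level + 1)).proj = y} := by
  ext w
  have : w ∈ cylinder (P.snoc h) ↔ w ∈ cylinder P ∧ w.1 (a.level + 1) = next a h := by
    constructor
    · intro hw
      refine ⟨fun i => ?_, mem_cylinder_level hw⟩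
      have := hw i.castSucc
      simpa [FinPath.snoc] using this
    · rintro ⟨hw, hw'⟩ i
      induction i using Fin.lastCases with
      | last => simpa [FinPath.snoc] using hw'
      | cast i => simpa [FinPath.snoc] using hw i
  rw [this]
  exact and_congr_right fun _ => dynVertex_eq_iff (a := next a h) w

theorem cylinder_ofPath (w : Paths G v₀) (n : ℕ) :
    cylinder (FinPath.ofPath w n) = {w' | ∀ i ≤ n, w'.1 i = w.1 i} := by
  ext w'
  simp only [cylinder, FinPath.ofPath, Set.mem_ofPred_eq, Fin.forall_iff, level_path,
    Nat.lt_succ_iff]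

theorem cylinder_subset_through {v : DynVertex G v₀} (P : FinPath v) : cylinder P ⊆ through v :=
  fun _ h => mem_cylinder_level h

theorem measurable_coord (n : ℕ) : Measurable fun w : Paths G v₀ => w.1 n :=
  (measurable_pi_apply n).comp measurable_subtype_coe

theorem measurableSet_coord (n : ℕ) (s : Set (DynVertex G v₀)) :
    MeasurableSet {w : Paths G v₀ | w.1 n ∈ s} :=
  measurable_coord n (show MeasurableSet s from trivial)

theorem measurableSet_proj (n : ℕ) (y : V) :
    MeasurableSet {w : Paths G v₀ | (w.1 n).proj = y} :=
  measurableSet_coord n {a | a.proj = y}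

theorem measurableSet_cylinder {v : DynVertex G v₀} (P : FinPath v) :
    MeasurableSet (cylinder P) := by
  have : cylinder P = ⋂ i : Fin (v.level + 1), {w | w.1 i ∈ ({P.vert i} : Set _)} := by
    ext w; simp [cylinder]
  rw [this]
  exact MeasurableSet.iInter fun i => measurableSet_coord _ _

theorem measurableSet_through (v : DynVertex G v₀) : MeasurableSet (through v) :=
  measurableSet_coord v.level {v}

theorem cylinder_eq_iUnion [G.LocallyFinite] {a : DynVertex G v₀} (P : FinPath a) :
    cylinder P = ⋃ y ∈ G.neighborFinset a.proj,
      cylinder P ∩ {w | (w.1 (a.level + 1)).proj = y} := by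
  ext w
  simp only [Set.mem_iUnion, Set.mem_inter_iff, Set.mem_ofPred_eq, mem_neighborFinset,
    exists_prop]
  constructor
  · intro hw
    refine ⟨_, ?_, hw, rfl⟩
    have := adj_path w a.level
    rwa [mem_cylinder_level hw] at this
  · rintro ⟨_, _, hw, _⟩
    exact hw

theorem setIntegral_cylinder [G.LocallyFinite] (ν : Measure (Paths G v₀)) {a : DynVertex G v₀}
    (P : FinPath a) {f : Paths G v₀ → ℝ} (hf : Integrable f ν) :
    ∫ w in cylinder P, f w ∂ν = ∑ y ∈ G.neighborFinset a.proj,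
      ∫ w in cylinder P ∩ {w | (w.1 (a.level + 1)).proj = y}, f w ∂ν := by
  conv_lhs => rw [cylinder_eq_iUnion P]
  refine integral_biUnion_finset _ (fun y _ => ?_) ?_ fun y _ => hf.integrableOn
  · exact (measurableSet_cylinder P).inter (measurableSet_proj _ _)
  · intro y _ z _ hyz
    refine Set.disjoint_left.2 fun w hw hw' => hyz (hw.2.symm.trans hw'.2)

theorem isCentral_iff (ν : Measure (Paths G v₀)) [IsFiniteMeasure ν] :
    IsCentral ν ↔ ∀ (v : DynVertex G v₀) (P P' : FinPath v),
      ν.real (cylinder P) = ν.real (cylinder P') := by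
  refine forall_congr' fun v => forall_congr' fun P => forall_congr' fun P' => ?_
  rw [cond_apply (measurableSet_through v), cond_apply (measurableSet_through v),
    Set.inter_eq_right.2 (cylinder_subset_through P),
    Set.inter_eq_right.2 (cylinder_subset_through P')]
  by_cases h0 : ν (through v) = 0
  · simp [measureReal_def, measure_mono_null (cylinder_subset_through _) h0]
  · rw [ENNReal.mul_right_inj (ENNReal.inv_ne_zero.2 (measure_ne_top _ _))
      (ENNReal.inv_ne_top.2 h0), measureReal_def, measureReal_def,
      ENNReal.toReal_eq_toReal_iff' (measure_ne_top _ _) (measure_ne_top _ _)]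

open Classical in
/-- The measure of a cylinder over a path of length `n` ending at `x`. -/
noncomputable def cylinderValue (ν : Measure (Paths G v₀)) (n : ℕ) (x : V) : ℝ :=
  -- For a central measure the choice of the path is immaterial. The value 0 elsewhere keeps the
  -- function nonnegative everywhere.
  if h : Reach G v₀ n x then ν.real (cylinder (FinPath.nonempty_mk n x h).some) else 0

theorem cylinderValue_nonneg (ν : Measure (Paths G v₀)) (n : ℕ) (x : V) :
    0 ≤ cylinderValue ν n x := by
  unfold cylinderValue
  split_ifs <;> simp

theorem IsCentral.real_cylinder {ν : Measure (Paths G v₀)} [IsFiniteMeasure ν] (h : IsCentral ν)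
    {v : DynVertex G v₀} (P : FinPath v) :
    ν.real (cylinder P) = cylinderValue ν v.level v.proj := by
  have hv : Reach G v₀ v.level v.proj := v.reachable
  rw [cylinderValue, dif_pos hv]
  exact (isCentral_iff ν).1 h v P _

theorem cylinder_nil : cylinder (FinPath.nil (G := G) (v₀ := v₀)) = Set.univ := by
  refine Set.eq_univ_of_forall fun w i => ?_
  have : i = 0 := Subsingleton.elim (α := Fin 1) _ _
  subst this
  exact w.2.1

theorem cylinderValue_root {ν : Measure (Paths G v₀)} [IsProbabilityMeasure ν]
    (h : IsCentral ν) : cylinderValue ν 0 v₀ = 1 := by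
  have h1 := h.real_cylinder (FinPath.nil (G := G) (v₀ := v₀))
  rw [cylinder_nil, probReal_univ] at h1
  exact h1.symm

variable [G.LocallyFinite]

variable (G v₀) in
/-- Harmonicity on the dynamic graph. -/
def IsDynHarmonic (g : ℕ → V → ℝ) : Prop :=
  ∀ n x, Reach G v₀ n x → g n x = ∑ y ∈ G.neighborFinset x, g (n + 1) y

/-- A cylinder is the disjoint union of its one-step extensions. -/
theorem IsCentral.isDynHarmonic {ν : Measure (Paths G v₀)} [IsFiniteMeasure ν]
    (h : IsCentral ν) : IsDynHarmonic G v₀ (cylinderValue ν) := by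
  intro n x hx
  obtain ⟨P⟩ := FinPath.nonempty_mk n x hx
  have h1 := setIntegral_cylinder ν P (f := fun _ => (1 : ℝ)) (integrable_const _)
  simp only [setIntegral_const, smul_eq_mul, mul_one] at h1
  rw [h.real_cylinder] at h1
  refine h1.trans (Finset.sum_congr rfl fun y hy => ?_)
  have hy' : G.Adj x y := by simpa using hy
  have h2 := cylinder_snoc P hy'
  rw [← h2, h.real_cylinder]

/-- A vanishing sum of nonnegative terms vanishes termwise, so zeros propagate from a vertex to its
successors. -/
theorem IsDynHarmonic.nonneg_eq_zero {g : ℕ → V → ℝ} (hg : IsDynHarmonic G v₀ g)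
    (hg0 : ∀ n x, Reach G v₀ n x → 0 ≤ g n x) (h0 : g 0 v₀ = 0) {n : ℕ} {x : V}
    (hx : Reach G v₀ n x) : g n x = 0 := by
  induction n generalizing x with
  | zero => rw [hx.eq_of_zero, h0]
  | succ n ih =>
    obtain ⟨y, hy, hyx⟩ := hx.exists_of_succ
    have h1 := hg n y hy
    rw [ih hy, eq_comm, Finset.sum_eq_zero_iff_of_nonneg] at h1
    · exact h1 x (by simpa using hyx)
    · intro z hz
      exact hg0 _ _ (hy.succ (by simpa using hz))

end DynamicGraph

/-! ### Ergodic measures have minimal harmonic functions: the martingale argument. -/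

namespace DynamicGraph

open SimpleGraph

variable {V : Type*} {G : SimpleGraph V} {v₀ : V}

/-- The first `n` steps of a path. -/
def restrictPath (n : ℕ) (w : Paths G v₀) : Fin (n + 1) → DynVertex G v₀ := fun i => w.1 i

theorem measurable_restrictPath (n : ℕ) :
    Measurable (restrictPath (G := G) (v₀ := v₀) n) :=
  measurable_pi_lambda _ fun i => measurable_coord (i : ℕ)

variable (G v₀) in
/-- The filtration generated by the coordinates. -/
def coordFiltration : Filtration ℕ (inferInstance : MeasurableSpace (Paths G v₀)) where
  seq n := MeasurableSpace.comap (restrictPath n) inferInstance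
  mono' m n hmn := by
    have : restrictPath (G := G) (v₀ := v₀) m =
        (fun (a : Fin (n + 1) → DynVertex G v₀) (i : Fin (m + 1)) =>
          a (Fin.castLE (by omega) i)) ∘ restrictPath n := rfl
    change MeasurableSpace.comap (restrictPath m) _ ≤ MeasurableSpace.comap (restrictPath n) _
    rw [this, ← MeasurableSpace.comap_comp]
    exact MeasurableSpace.comap_mono
      (Measurable.comap_le (measurable_pi_lambda _ fun i => measurable_pi_apply _))
  le' n := (measurable_restrictPath n).comap_le

/-- The density along paths of one harmonic function with respect to another. -/
noncomputable def pathRatio (g h : ℕ → V → ℝ) (n : ℕ) (w : Paths G v₀) : ℝ :=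
  g n (w.1 n).proj / h n (w.1 n).proj

section Ratio

variable {g h : ℕ → V → ℝ}

theorem pathRatio_nonneg (hg : ∀ n x, Reach G v₀ n x → 0 ≤ g n x)
    (hgh : ∀ n x, Reach G v₀ n x → g n x ≤ h n x) (n : ℕ) (w : Paths G v₀) :
    0 ≤ pathRatio g h n w :=
  div_nonneg (hg _ _ (reach_path w n)) ((hg _ _ (reach_path w n)).trans (hgh _ _ (reach_path w n)))

theorem pathRatio_le_one (hg : ∀ n x, Reach G v₀ n x → 0 ≤ g n x)
    (hgh : ∀ n x, Reach G v₀ n x → g n x ≤ h n x) (n : ℕ) (w : Paths G v₀) :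
    pathRatio g h n w ≤ 1 :=
  div_le_one_of_le₀ (hgh _ _ (reach_path w n))
    ((hg _ _ (reach_path w n)).trans (hgh _ _ (reach_path w n)))

theorem stronglyAdapted_pathRatio :
    StronglyAdapted (coordFiltration G v₀) (pathRatio g h) := by
  intro n
  refine Measurable.stronglyMeasurable ?_
  have h1 : Measurable[coordFiltration G v₀ n] (fun w : Paths G v₀ => w.1 n) := by
    have : (fun w : Paths G v₀ => w.1 n) =
      (fun a : Fin (n + 1) → DynVertex G v₀ => a (Fin.last n)) ∘ restrictPath n := rfl
    rw [this]
    exact (measurable_pi_apply _).comp (comap_measurable _)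
  have h2 : Measurable fun a : DynVertex G v₀ => g n a.proj / h n a.proj :=
    fun s _ => trivial
  exact h2.comp h1

theorem measurable_pathRatio (n : ℕ) :
    Measurable (pathRatio (G := G) (v₀ := v₀) g h n) :=
  (stronglyAdapted_pathRatio n).measurable.mono ((coordFiltration G v₀).le n) le_rfl

theorem norm_pathRatio_le (hg : ∀ n x, Reach G v₀ n x → 0 ≤ g n x)
    (hgh : ∀ n x, Reach G v₀ n x → g n x ≤ h n x) (n : ℕ) (w : Paths G v₀) :
    ‖pathRatio g h n w‖ ≤ 1 := by
  rw [Real.norm_of_nonneg (pathRatio_nonneg hg hgh n w)]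
  exact pathRatio_le_one hg hgh n w

theorem integrable_pathRatio (ν : Measure (Paths G v₀)) [IsFiniteMeasure ν]
    (hg : ∀ n x, Reach G v₀ n x → 0 ≤ g n x) (hgh : ∀ n x, Reach G v₀ n x → g n x ≤ h n x)
    (n : ℕ) : Integrable (pathRatio g h n) ν :=
  Integrable.of_bound (measurable_pathRatio n).aestronglyMeasurable 1
    (ae_of_all _ fun w => norm_pathRatio_le hg hgh n w)

end Ratio

section Density

theorem withDensity_real_eq {ν : Measure (Paths G v₀)} {N : Paths G v₀ → ℝ}
    (hN : Measurable N) (hN0 : ∀ w, 0 ≤ N w)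
    {s : Set (Paths G v₀)} (hs : MeasurableSet s) :
    (ν.withDensity fun w => ENNReal.ofReal (N w)).real s = ∫ w in s, N w ∂ν := by
  rw [measureReal_def, withDensity_apply _ hs,
    integral_eq_lintegral_of_nonneg_ae (ae_of_all _ hN0) hN.aestronglyMeasurable]

/-- The new measure of a cylinder depends only on the endpoint of the path, which is centrality; the
normalisation is the value at the root. -/
theorem withDensity_mem_centralMeasures {ν : Measure (Paths G v₀)} {N : Paths G v₀ → ℝ}
    (hN : Measurable N) (hN0 : ∀ w, 0 ≤ N w)
    (hNi : Integrable N ν) {k : ℕ → V → ℝ} (hk : k 0 v₀ = 1)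
    (hNk : ∀ (v : DynVertex G v₀) (P : FinPath v),
      ∫ w in cylinder P, N w ∂ν = k v.level v.proj) :
    (ν.withDensity fun w => ENNReal.ofReal (N w)) ∈ centralMeasures G v₀ := by
  have hprob : IsProbabilityMeasure (ν.withDensity fun w => ENNReal.ofReal (N w)) := by
    constructor
    have h1 := hNk _ (FinPath.nil (G := G) (v₀ := v₀))
    rw [cylinder_nil, setIntegral_univ] at h1
    rw [withDensity_apply _ MeasurableSet.univ, setLIntegral_univ,
      ← ofReal_integral_eq_lintegral_ofReal hNi (ae_of_all _ hN0), h1]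
    exact (congrArg _ hk).trans ENNReal.ofReal_one
  refine ⟨hprob, (isCentral_iff _).2 fun v P P' => ?_⟩
  rw [withDensity_real_eq hN hN0 (measurableSet_cylinder P),
    withDensity_real_eq hN hN0 (measurableSet_cylinder P'), hNk, hNk]

variable [G.LocallyFinite] {ν : Measure (Paths G v₀)} [IsProbabilityMeasure ν] {g : ℕ → V → ℝ}

/-- On the cylinder's own level the ratio is constant and the cylinder's measure cancels its
denominator. Where that measure is zero, domination makes `g` zero too. Harmonicity of `g` carries
the identity to later levels. -/
theorem setIntegral_pathRatio (hc : IsCentral ν) (hharm : IsDynHarmonic G v₀ g)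
    (hg : ∀ n x, Reach G v₀ n x → 0 ≤ g n x)
    (hgh : ∀ n x, Reach G v₀ n x → g n x ≤ cylinderValue ν n x) (k : ℕ) {v : DynVertex G v₀}
    (P : FinPath v) :
    ∫ w in cylinder P, pathRatio g (cylinderValue ν) (v.level + k) w ∂ν =
      g v.level v.proj := by
  induction k generalizing v with
  | zero =>
    have h1 : ∀ w ∈ cylinder P, pathRatio g (cylinderValue ν) (v.level + 0) w =
        g v.level v.proj / cylinderValue ν v.level v.proj := by
      intro w hw
      rw [pathRatio, Nat.add_zero, mem_cylinder_level hw]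
    rw [setIntegral_congr_fun (measurableSet_cylinder P) h1, setIntegral_const,
      hc.real_cylinder, smul_eq_mul]
    have h2 := hg _ _ v.reachable
    have h3 := hgh _ _ v.reachable
    by_cases h0 : cylinderValue ν v.level v.proj = 0
    · rw [h0] at h3 ⊢
      rw [zero_mul]
      exact le_antisymm h2 h3
    · field_simp
  | succ k ih =>
    rw [setIntegral_cylinder ν P (integrable_pathRatio ν hg hgh _), hharm _ _ v.reachable]
    refine Finset.sum_congr rfl fun y hy => ?_
    have hy' : G.Adj v.proj y := by simpa using hy
    have h1 := ih (P.snoc hy')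
    rw [← cylinder_snoc P hy', ← h1]
    have : v.level + (k + 1) = (next v hy').level + k := by
      change _ = v.level + 1 + k
      omega
    rw [this]

theorem submartingale_pathRatio (hc : IsCentral ν) (hharm : IsDynHarmonic G v₀ g)
    (hg : ∀ n x, Reach G v₀ n x → 0 ≤ g n x)
    (hgh : ∀ n x, Reach G v₀ n x → g n x ≤ cylinderValue ν n x) :
    Submartingale (pathRatio g (cylinderValue ν)) (coordFiltration G v₀) ν := by
  have := countable_dynVertex (G := G) (v₀ := v₀)
  have hint := integrable_pathRatio ν hg hgh
  refine submartingale_of_setIntegral_le_succ stronglyAdapted_pathRatio hint ?_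
  rintro n _ ⟨S, -, rfl⟩
  -- An event of the first `n` steps is a countable disjoint union of fibres, each empty or a
  -- cylinder; on cylinders the integrals at times `n` and `n + 1` agree.
  have hS : restrictPath (G := G) (v₀ := v₀) n ⁻¹' S = ⋃ a : S, restrictPath n ⁻¹' {a.1} := by
    ext w; simp
  have hmeas : ∀ a : S, MeasurableSet (restrictPath (G := G) (v₀ := v₀) n ⁻¹' {a.1}) :=
    fun a => measurable_restrictPath n (MeasurableSet.singleton _)
  have hdisj : Pairwise (Function.onFun Disjoint
      fun a : S => restrictPath (G := G) (v₀ := v₀) n ⁻¹' {a.1}) := by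
    intro a b hab
    refine Set.disjoint_left.2 fun w hw hw' => hab (Subtype.ext (hw.symm.trans hw'))
  rw [hS, integral_iUnion hmeas hdisj (hint n).integrableOn,
    integral_iUnion hmeas hdisj (hint (n + 1)).integrableOn]
  refine le_of_eq (tsum_congr fun a => ?_)
  rcases (restrictPath (G := G) (v₀ := v₀) n ⁻¹' {a.1}).eq_empty_or_nonempty with h0 | ⟨w, hw⟩
  · simp [h0]
  · have h1 : restrictPath n ⁻¹' {a.1} = cylinder (FinPath.ofPath w n) := by
      ext w'
      rw [cylinder_ofPath, ← (show restrictPath n w = a.1 from hw)]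
      simp only [Set.mem_preimage, Set.mem_singleton_iff, funext_iff, restrictPath,
        Fin.forall_iff, Nat.lt_succ_iff]
      rfl
    have h2 := setIntegral_pathRatio hc hharm hg hgh 0 (FinPath.ofPath w n)
    have h3 := setIntegral_pathRatio hc hharm hg hgh 1 (FinPath.ofPath w n)
    rw [← h3, level_path] at h2
    rw [h1]
    exact h2

theorem exists_density (hc : IsCentral ν) (hharm : IsDynHarmonic G v₀ g)
    (hg : ∀ n x, Reach G v₀ n x → 0 ≤ g n x)
    (hgh : ∀ n x, Reach G v₀ n x → g n x ≤ cylinderValue ν n x) :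
    ∃ M : Paths G v₀ → ℝ, Measurable M ∧ (∀ w, 0 ≤ M w) ∧ (∀ w, M w ≤ 1) ∧
      ∀ (v : DynVertex G v₀) (P : FinPath v),
        ∫ w in cylinder P, M w ∂ν = g v.level v.proj := by
  have hsub := submartingale_pathRatio hc hharm hg hgh
  have hbdd : ∀ n, eLpNorm (pathRatio g (cylinderValue ν) n) 1 ν ≤ (1 : ℝ≥0) := by
    intro n
    refine (eLpNorm_le_of_ae_bound (C := 1)
      (ae_of_all _ fun w => norm_pathRatio_le hg hgh n w)).trans ?_
    simp
  obtain ⟨L, hmeas, hlim⟩ := measurable_limit_of_tendsto_metrizable_ae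
    (fun n => (measurable_pathRatio n).aemeasurable) (hsub.exists_ae_tendsto_of_bdd hbdd)
  -- The limit lies in [0, 1] only almost everywhere; clipping makes the bounds hold everywhere.
  refine ⟨fun w => min 1 (max 0 (L w)),
    measurable_const.min (measurable_const.max hmeas),
    fun w => le_min zero_le_one (le_max_left _ _), fun w => min_le_left _ _, fun v P => ?_⟩
  have h1 := tendsto_integral_of_dominated_convergence (μ := ν.restrict (cylinder P))
    (F := pathRatio g (cylinderValue ν)) (f := fun w => min 1 (max 0 (L w)))
    (fun _ => 1) (fun n => (measurable_pathRatio n).aestronglyMeasurable)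
    (integrable_const _) (fun n => ae_of_all _ fun w => norm_pathRatio_le hg hgh n w)
    (ae_restrict_of_ae (hlim.mono fun w hw => by
      have h2 := ge_of_tendsto' hw fun n => pathRatio_nonneg hg hgh n w
      have h3 := le_of_tendsto' hw fun n => pathRatio_le_one hg hgh n w
      rwa [max_eq_right h2, min_eq_right h3]))
  refine tendsto_nhds_unique h1 (tendsto_const_nhds.congr' ?_)
  filter_upwards [eventually_ge_atTop v.level] with n hn
  obtain ⟨k, rfl⟩ := Nat.exists_eq_add_of_le hn
  exact (setIntegral_pathRatio hc hharm hg hgh k P).symm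

end Density

/-- The harmonic function of an ergodic central measure is minimal. -/
theorem IsErgodicCentral.eq_mul [G.LocallyFinite] {ν : Measure (Paths G v₀)}
    (hν : IsErgodicCentral ν) {g : ℕ → V → ℝ} (hharm : IsDynHarmonic G v₀ g)
    (hg : ∀ n x, Reach G v₀ n x → 0 ≤ g n x)
    (hgh : ∀ n x, Reach G v₀ n x → g n x ≤ cylinderValue ν n x) {n : ℕ} {x : V}
    (hx : Reach G v₀ n x) : g n x = g 0 v₀ * cylinderValue ν n x := by
  obtain ⟨⟨hprob, hc⟩, hext⟩ := hν
  have hroot := cylinderValue_root hc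
  have ha0 := hg 0 v₀ Reach.zero
  have ha1 := hgh 0 v₀ Reach.zero
  rw [hroot] at ha1
  -- The values 0 and 1 at the root are treated apart, since the two densities below are divided by
  -- `a` and `1 - a`.
  rcases ha0.eq_or_lt with h0 | h0
  · rw [← h0, zero_mul]
    exact hharm.nonneg_eq_zero hg h0.symm hx
  rcases ha1.eq_or_lt with h1 | h1
  · have hd : IsDynHarmonic G v₀ fun n x => cylinderValue ν n x - g n x := by
      intro n x hx
      simp only [Finset.sum_sub_distrib]
      rw [← hharm n x hx, ← hc.isDynHarmonic n x hx]
    have := hd.nonneg_eq_zero (fun n x hx => sub_nonneg.2 (hgh n x hx))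
      (by rw [hroot, h1, sub_self]) hx
    rw [h1, one_mul]
    linarith
  obtain ⟨M, hM, hM0, hM1, hMg⟩ := exists_density hc hharm hg hgh
  set a := g 0 v₀ with ha
  have hMi : Integrable M ν := Integrable.of_bound hM.aestronglyMeasurable 1
    (ae_of_all _ fun w => by rw [Real.norm_of_nonneg (hM0 w)]; exact hM1 w)
  have hmem1 := withDensity_mem_centralMeasures (ν := ν) (N := fun w => M w / a)
    (k := fun n x => g n x / a) (hM.div_const a) (fun w => div_nonneg (hM0 w) h0.le)
    (hMi.div_const a) (div_self h0.ne') fun v P => by rw [integral_div, hMg]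
  have hmem2 := withDensity_mem_centralMeasures (ν := ν) (N := fun w => (1 - M w) / (1 - a))
    (k := fun n x => (cylinderValue ν n x - g n x) / (1 - a))
    ((measurable_const.sub hM).div_const _)
    (fun w => div_nonneg (sub_nonneg.2 (hM1 w)) (sub_nonneg.2 h1.le))
    (((integrable_const _).sub hMi).div_const _)
    (by rw [hroot, ← ha, div_self (sub_pos.2 h1).ne'])
    fun v P => by
      rw [integral_div, integral_sub (integrable_const _) hMi.integrableOn, hMg,
        setIntegral_const, hc.real_cylinder, smul_eq_mul, mul_one]
  -- The two normalised densities, weighted by `a` and `1 - a`, add up to 1.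
  have hseg : ν ∈ openSegment ℝ≥0 (ν.withDensity fun w => ENNReal.ofReal (M w / a))
      (ν.withDensity fun w => ENNReal.ofReal ((1 - M w) / (1 - a))) := by
    refine ⟨⟨a, h0.le⟩, ⟨1 - a, sub_nonneg.2 h1.le⟩, h0, sub_pos.2 h1,
      NNReal.eq (add_sub_cancel a 1), ?_⟩
    have e1 : ∀ (b : ℝ≥0) (hb : 0 < b) (f : Paths G v₀ → ℝ), Measurable f →
        b • ν.withDensity (fun w => ENNReal.ofReal (f w / (b : ℝ))) =
          ν.withDensity fun w => ENNReal.ofReal (f w) := by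
      intro b hb f hf
      have : b • ν.withDensity (fun w => ENNReal.ofReal (f w / (b : ℝ))) =
          (b : ℝ≥0∞) • ν.withDensity (fun w => ENNReal.ofReal (f w / (b : ℝ))) := rfl
      rw [this, ← withDensity_smul _ (hf.div_const _).ennreal_ofReal]
      congr 1
      funext w
      simp only [Pi.smul_apply, smul_eq_mul]
      rw [← ENNReal.ofReal_coe_nnreal, ← ENNReal.ofReal_mul b.coe_nonneg]
      congr 1
      have : (b : ℝ) ≠ 0 := by exact_mod_cast hb.ne'
      field_simp
    refine (congrArg₂ (· + ·) (e1 ⟨a, h0.le⟩ h0 M hM) (e1 ⟨1 - a, sub_nonneg.2 h1.le⟩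
      (sub_pos.2 h1) (fun w => 1 - M w) (measurable_const.sub hM))).trans ?_
    rw [← withDensity_add_left hM.ennreal_ofReal]
    have : ((fun w => ENNReal.ofReal (M w)) + fun w => ENNReal.ofReal (1 - M w)) = 1 := by
      funext w
      simp only [Pi.add_apply, Pi.one_apply]
      rw [← ENNReal.ofReal_add (hM0 w) (sub_nonneg.2 (hM1 w))]
      simp
    rw [this, withDensity_one]
  have heq := hext hmem1 hmem2 hseg
  obtain ⟨P⟩ := FinPath.nonempty_mk n x hx
  have h2 := withDensity_real_eq (ν := ν) (hM.div_const a) (fun w => div_nonneg (hM0 w) h0.le)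
    (measurableSet_cylinder P)
  rw [heq, hc.real_cylinder, integral_div, hMg] at h2
  rw [h2]
  field_simp

end DynamicGraph

/-! ### Minimal positive eigenfunctions on a regular tree. -/

namespace DynamicGraph

open SimpleGraph

variable {V : Type*} {G : SimpleGraph V}

/-- The edge inequality is iterated along a geodesic. -/
theorem pow_dist_mul_le (hT : G.IsTree) {f : V → ℝ} {s : ℝ} (hs : 0 < s)
    (hf : ∀ x y, G.Adj x y → s * f x ≤ f y) (x y : V) : s ^ G.dist y x * f x ≤ f y := by
  obtain ⟨p, hp⟩ := hT.connected.exists_walk_length_eq_dist y x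
  rw [← hp]
  clear hp
  induction p with
  | nil => simp
  | cons h p ih =>
    rename_i u v w
    rw [Walk.length_cons, pow_succ', mul_assoc]
    exact (mul_le_mul_of_nonneg_left ih hs.le).trans (hf _ _ h.symm)

/-- Following the increasing edges of an eigenfunction leads to a single end. -/
theorem exists_end_of_parent (hT : G.IsTree) {s : ℝ} {f : V → ℝ} (hpos : ∀ x, 0 < f x)
    (hs0 : 0 < s) (hs1 : s < 1) {σ : V → V} (hσ : ∀ x, G.Adj x (σ x))
    (hfσ : ∀ x, f x = s * f (σ x)) (hother : ∀ x z, G.Adj x z → z ≠ σ x → f z = s * f x) :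
    ∃ ω : G.end, ∀ x y, G.Adj x y → (LiesBetween ω x y ↔ y = σ x) := by
  have hH : ∀ x y, G.Adj x y → s * f x ≤ f y := by
    intro x y hxy
    by_cases h : y = σ x
    · rw [h]
      have h1 := hfσ x
      have h2 := hpos (σ x)
      have h3 : s * (s * f (σ x)) ≤ 1 * (1 * f (σ x)) := by gcongr
      rw [← h1] at h3
      linarith
    · exact (hother x y hxy h).ge
  set γ : V → ℕ → V := fun x n => σ^[n] x with hγ
  have hstep : ∀ x n, γ x (n + 1) = σ (γ x n) := fun x n => Function.iterate_succ_apply' σ n x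
  have hfk : ∀ x m k, f (γ x m) = s ^ k * f (γ x (m + k)) := by
    intro x m k
    induction k with
    | zero => simp
    | succ k ih => rw [ih, ← add_assoc, hstep, hfσ (γ x (m + k)), pow_succ, mul_assoc]
  have hgeo : ∀ x, IsGeodesicRay (G := G) (γ x) := by
    intro x m k
    refine ⟨hT.connected _ _, le_antisymm ?_ ?_⟩
    · induction k with
      | zero => simp
      | succ k ih =>
        refine (hT.connected.dist_triangle (v := γ x (m + k))).trans ?_
        have : G.dist (γ x (m + k)) (γ x (m + (k + 1))) = 1 :=
          SimpleGraph.dist_eq_one_iff_adj.2 (by rw [← add_assoc, hstep]; exact hσ _)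
        omega
    -- Along the orbit `f` grows by exactly `1 / s` per step, the fastest rate the edge inequality
    -- allows, so no shortcut exists.
    · have h1 := pow_dist_mul_le hT hs0 hH (γ x (m + k)) (γ x m)
      rw [hfk x m k] at h1
      exact (pow_le_pow_iff_right_of_lt_one₀ hs0 hs1).1 (le_of_mul_le_mul_right h1 (hpos _))
  obtain ⟨v₀⟩ := hT.connected.nonempty
  obtain ⟨ω, hω⟩ := (hgeo v₀).exists_end
  have hshift : ∀ x, (fun n => γ x (n + 1)) = γ (σ x) := by
    intro x
    funext n
    exact Function.iterate_succ_apply σ n x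
  have hall : ∀ x, TendsToEnd ω (γ x) := by
    have key : ∀ {u w : V}, G.Walk u w → TendsToEnd ω (γ u) → TendsToEnd ω (γ w) := by
      intro u w p
      induction p with
      | nil => exact id
      | cons h p ih =>
        rename_i u v w
        intro hu
        refine ih ?_
        by_cases hv : v = σ u
        · rw [hv, ← hshift]
          exact hu.shift
        -- If neither endpoint were the parent of the other, `f` would shrink by `s` in both
        -- directions.
        · have h1 := hother u v h hv
          have h2 : u = σ v := by
            by_contra hne
            have h3 := hother v u h.symm hne
            have h4 := hpos u
            rw [h1] at h3
            have h5 : s * (s * f u) < 1 * (1 * f u) := by gcongr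
            linarith
          rw [h2, ← hshift] at hu
          exact hu.of_shift
    intro x
    obtain ⟨p⟩ := hT.connected v₀ x
    exact key p hω
  refine ⟨ω, fun x y hxy => ?_⟩
  exact liesBetween_iff_of_adj hT (hgeo x) (hall x) hxy

variable [G.LocallyFinite]

variable (G) in
/-- `f` is an eigenfunction of the adjacency operator with eigenvalue `t`. -/
def IsEigen (t : ℝ) (f : V → ℝ) : Prop := ∀ x, ∑ y ∈ G.neighborFinset x, f y = t * f x

theorem sum_neighborFinset_eq_of_adj {q : ℕ} (hreg : G.IsRegularOfDegree (q + 1)) {x y : V}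
    (hxy : G.Adj x y) {f : V → ℝ} {c : ℝ} (hf : ∀ z, G.Adj x z → z ≠ y → f z = c) :
    ∑ z ∈ G.neighborFinset x, f z = f y + q * c := by
  classical
  have hmem : y ∈ G.neighborFinset x := by simpa using hxy
  rw [← Finset.add_sum_erase _ _ hmem, Finset.sum_congr rfl (g := fun _ => c),
    Finset.sum_const, Finset.card_erase_of_mem hmem, card_neighborFinset_eq_degree, hreg x]
  · simp
  · intro z hz
    rw [Finset.mem_erase, mem_neighborFinset] at hz
    exact hf z hz.2 hz.1

theorem add_mul_le_sum_neighborFinset {q : ℕ} (hreg : G.IsRegularOfDegree (q + 1)) {x y : V}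
    (hxy : G.Adj x y) {f : V → ℝ} {c : ℝ} (hf : ∀ z, G.Adj x z → c ≤ f z) :
    f y + q * c ≤ ∑ z ∈ G.neighborFinset x, f z := by
  classical
  have hmem : y ∈ G.neighborFinset x := by simpa using hxy
  rw [← Finset.add_sum_erase _ _ hmem]
  have h1 := Finset.card_nsmul_le_sum ((G.neighborFinset x).erase y) f c (fun z hz => by
    rw [Finset.mem_erase, mem_neighborFinset] at hz
    exact hf z hz.2)
  rw [Finset.card_erase_of_mem hmem, card_neighborFinset_eq_degree, hreg x] at h1
  simp only [Nat.add_sub_cancel, nsmul_eq_mul] at h1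
  linarith

/-- The sharp Harnack inequality for positive eigenfunctions on a regular tree. -/
theorem IsEigen.exists_harnack {q : ℕ} (hq : 2 ≤ q) (hreg : G.IsRegularOfDegree (q + 1))
    [Nonempty V] {t : ℝ} {f : V → ℝ} (hf : IsEigen G t f) (hpos : ∀ x, 0 < f x) :
    ∃ s : ℝ, 0 < s ∧ s < 1 ∧ t = 1 / s + q * s ∧ ∀ x y, G.Adj x y → s * f x ≤ f y := by
  have hq' : (2 : ℝ) ≤ q := by exact_mod_cast hq
  have hex : ∀ x, ∃ y, G.Adj x y := by
    intro x
    have : 0 < G.degree x := by rw [hreg x]; omega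
    exact (G.degree_pos_iff_exists_adj x).1 this
  have hle : ∀ x y, G.Adj x y → f x ≤ t * f y := by
    intro x y hxy
    rw [← hf y]
    exact Finset.single_le_sum (fun z _ => (hpos z).le) (by simpa using hxy.symm)
  have ht : 0 < t := by
    obtain ⟨x⟩ := ‹Nonempty V›
    obtain ⟨y, hxy⟩ := hex x
    exact pos_of_mul_pos_left ((hpos x).trans_le (hle x y hxy)) (hpos y).le
  -- The best constant `m` is the infimum of the edge ratios. Inserting it into the eigenvalue
  -- equation improves the bound to `1 / (t - q * m)`, which therefore cannot exceed `m`.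
  set E : Set ℝ := {r | ∃ x y, G.Adj x y ∧ r = f y / f x} with hE
  have hEne : E.Nonempty := by
    obtain ⟨x⟩ := ‹Nonempty V›
    obtain ⟨y, hxy⟩ := hex x
    exact ⟨_, x, y, hxy, rfl⟩
  have hElb : ∀ r ∈ E, 1 / t ≤ r := by
    rintro r ⟨x, y, hxy, rfl⟩
    rw [div_le_div_iff₀ ht (hpos x), one_mul, mul_comm]
    exact hle x y hxy
  set m := sInf E with hm
  have hmpos : 0 < m := (one_div_pos.2 ht).trans_le (le_csInf hEne hElb)
  have hmf : ∀ x y, G.Adj x y → m * f x ≤ f y := by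
    intro x y hxy
    rw [← le_div_iff₀ (hpos x)]
    exact csInf_le ⟨1 / t, hElb⟩ ⟨x, y, hxy, rfl⟩
  have hstep : ∀ x y, G.Adj x y → f x ≤ (t - q * m) * f y := by
    intro x y hxy
    have h1 := add_mul_le_sum_neighborFinset hreg hxy.symm (c := m * f y) (hmf y)
    rw [hf y] at h1
    linarith
  have htm : 0 < t - q * m := by
    obtain ⟨x⟩ := ‹Nonempty V›
    obtain ⟨y, hxy⟩ := hex x
    exact pos_of_mul_pos_left ((hpos x).trans_le (hstep x y hxy)) (hpos y).le
  have hm1 : 1 / (t - q * m) ≤ m := by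
    refine le_csInf hEne ?_
    rintro r ⟨x, y, hxy, rfl⟩
    rw [div_le_div_iff₀ htm (hpos x), one_mul, mul_comm]
    exact hstep x y hxy
  rw [div_le_iff₀ htm] at hm1
  -- This is `q * m ^ 2 - t * m + 1 ≤ 0` with the square completed, so `m` lies between the roots;
  -- `s` below is the smaller root.
  have hD : (2 * q * m - t) ^ 2 ≤ t ^ 2 - 4 * q := by nlinarith
  have hD0 : 0 ≤ t ^ 2 - 4 * q := (sq_nonneg _).trans hD
  set R := √(t ^ 2 - 4 * q) with hR
  have hR0 : 0 ≤ R := Real.sqrt_nonneg _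
  have hR2 : R ^ 2 = t ^ 2 - 4 * q := Real.sq_sqrt hD0
  have hRt : R < t := by
    refine lt_of_pow_lt_pow_left₀ 2 ht.le ?_
    linarith
  have hRm : t - R ≤ 2 * q * m := by
    have := abs_le_of_sq_le_sq' (hD.trans_eq hR2.symm) hR0
    linarith [this.1]
  have hq0 : (0 : ℝ) < 2 * q := by linarith
  obtain ⟨s, hs⟩ : ∃ s, s = (t - R) / (2 * q) := ⟨_, rfl⟩
  have hs' : t - R = 2 * q * s := by rw [hs]; field_simp
  have hs0 : 0 < s := by rw [hs]; exact div_pos (by linarith) hq0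
  have hsm : s ≤ m := by
    have : (2 * q) * s ≤ (2 * q) * m := by linarith
    exact le_of_mul_le_mul_left this hq0
  have hquad : q * s ^ 2 - t * s + 1 = 0 := by
    have h1 : R = t - 2 * q * s := by linarith
    rw [h1] at hR2
    have h2 : (4 * q : ℝ) * (q * s ^ 2 - t * s + 1) = 0 := by linarith
    rcases mul_eq_zero.1 h2 with h | h
    · linarith
    · exact h
  refine ⟨s, hs0, ?_, ?_, fun x y hxy => ?_⟩
  -- The smaller root satisfies `2 * q * s ≤ t`, hence `q * s ^ 2 ≤ 1`, which is incompatible with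
  -- `1 ≤ s` and `2 ≤ q`.
  · by_contra! h
    nlinarith
  · field_simp
    linarith
  · exact (mul_le_mul_of_nonneg_right hsm (hpos x).le).trans (hmf x y hxy)

/-- A minimal positive eigenfunction changes by an extreme factor along every edge. -/
theorem IsEigen.eq_or_eq_of_minimal {q : ℕ} (hT : G.IsTree)
    (hreg : G.IsRegularOfDegree (q + 1)) {t s : ℝ} {f : V → ℝ} (hf : IsEigen G t f)
    (hs0 : 0 < s) (hs1 : s < 1) (ht : t = 1 / s + q * s)
    (hH : ∀ x y, G.Adj x y → s * f x ≤ f y)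
    (hmin : ∀ g : V → ℝ, IsEigen G t g → (∀ x, 0 ≤ g x) → (∀ x, g x ≤ f x) →
      ∃ c, ∀ x, g x = c * f x) {x y : V} (hxy : G.Adj x y) :
    f y = s * f x ∨ f x = s * f y := by
  classical
  have hd : 0 < 1 / s - s := by
    have : 1 < 1 / s := by rw [lt_div_iff₀ hs0]; linarith
    linarith
  -- `A` and `B` solve `f x = A + B / s`, `f y = A / s + B`. With them the exponential on the
  -- `x`-side and `f` minus an exponential on the `y`-side satisfy the eigenvalue equation at both
  -- ends of the edge.
  obtain ⟨A, hA⟩ : ∃ A, A = (f y - s * f x) / (1 / s - s) := ⟨_, rfl⟩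
  obtain ⟨B, hB⟩ : ∃ B, B = (f x - s * f y) / (1 / s - s) := ⟨_, rfl⟩
  have hA0 : 0 ≤ A := by rw [hA]; exact div_nonneg (sub_nonneg.2 (hH x y hxy)) hd.le
  have hB0 : 0 ≤ B := by rw [hB]; exact div_nonneg (sub_nonneg.2 (hH y x hxy.symm)) hd.le
  have hs2 : 1 - s ^ 2 ≠ 0 := by nlinarith
  have hfx : f x = A + B / s := by
    rw [hA, hB]; field_simp; ring
  have hfy : f y = A / s + B := by
    rw [hA, hB]; field_simp; ring
  have hside : ∀ w, G.dist w x = G.dist w y + 1 ∨ G.dist w y = G.dist w x + 1 :=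
    fun w => hT.dist_eq_dist_add_one_of_adj w hxy
  set g : V → ℝ := fun u => if G.dist u y = G.dist u x + 1 then A * s ^ G.dist u x
    else f u - B * s ^ G.dist u y with hg
  have gx : ∀ u, G.dist u y = G.dist u x + 1 → g u = A * s ^ G.dist u x :=
    fun u hu => if_pos hu
  have gy : ∀ u, G.dist u x = G.dist u y + 1 → g u = f u - B * s ^ G.dist u y :=
    fun u hu => if_neg (by omega)
  have hxx : G.dist x y = G.dist x x + 1 := by
    rw [SimpleGraph.dist_self, SimpleGraph.dist_eq_one_iff_adj.2 hxy]
  have hyy : G.dist y x = G.dist y y + 1 := by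
    rw [SimpleGraph.dist_self, SimpleGraph.dist_eq_one_iff_adj.2 hxy.symm]
  have gxx : g x = A := by rw [gx x hxx]; simp
  have gyy : g y = f y - B := by rw [gy y hyy]; simp
  have hgE : IsEigen G t g := by
    intro u
    rcases hside u with hu | hu
    · by_cases huy : u = y
      · subst huy
        have h1 := hf u
        have h2 := sum_neighborFinset_eq_of_adj hreg hxy.symm (f := fun z => f z - g z)
          (c := B * s) (fun z hz hzx => by
            have h3 := hT.side_of_adj hxy.symm hz hyy (Or.inr hzx)
            have h4 : G.dist z u = 1 := SimpleGraph.dist_eq_one_iff_adj.2 hz.symm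
            rw [gy z h3, h4]; ring)
        rw [Finset.sum_sub_distrib, h1, gxx] at h2
        rw [gyy]
        have h3 : f x - A = B / s := by linarith
        rw [h3] at h2
        have h4 : t * B = B / s + q * (B * s) := by rw [ht]; ring
        linarith
      · have h1 : ∀ z ∈ G.neighborFinset u, g z = f z - B * s ^ G.dist z y := by
          intro z hz
          rw [mem_neighborFinset] at hz
          exact gy z (hT.side_of_adj hxy.symm hz hu (Or.inl huy))
        rw [Finset.sum_congr rfl h1, Finset.sum_sub_distrib, hf u, ← Finset.mul_sum,
          hT.sum_pow_dist hreg huy hs0.ne' ht, gy u hu]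
        ring
    · by_cases hux : u = x
      · subst hux
        have h2 := sum_neighborFinset_eq_of_adj hreg hxy (f := g)
          (c := A * s) (fun z hz hzy => by
            have h3 := hT.side_of_adj hxy hz hxx (Or.inr hzy)
            have h4 : G.dist z u = 1 := SimpleGraph.dist_eq_one_iff_adj.2 hz.symm
            rw [gx z h3, h4]; ring)
        rw [h2, gyy, gxx, ht, hfy]
        ring
      · have h1 : ∀ z ∈ G.neighborFinset u, g z = A * s ^ G.dist z x := by
          intro z hz
          rw [mem_neighborFinset] at hz
          exact gx z (hT.side_of_adj hxy hz hu (Or.inl hux))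
        rw [Finset.sum_congr rfl h1, ← Finset.mul_sum,
          hT.sum_pow_dist hreg hux hs0.ne' ht, gx u hu]
        ring
  have hAx : A ≤ f x := by rw [hfx]; linarith [div_nonneg hB0 hs0.le]
  have hBy : B ≤ f y := by rw [hfy]; linarith [div_nonneg hA0 hs0.le]
  have hg0 : ∀ u, 0 ≤ g u := by
    intro u
    rcases hside u with hu | hu
    · rw [gy u hu, sub_nonneg]
      refine le_trans ?_ (pow_dist_mul_le hT hs0 hH y u)
      rw [mul_comm]
      exact mul_le_mul_of_nonneg_left hBy (pow_pos hs0 _).le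
    · rw [gx u hu]
      exact mul_nonneg hA0 (pow_pos hs0 _).le
  have hgf : ∀ u, g u ≤ f u := by
    intro u
    rcases hside u with hu | hu
    · rw [gy u hu]
      linarith [mul_nonneg hB0 (pow_pos hs0 (G.dist u y)).le]
    · rw [gx u hu]
      refine le_trans ?_ (pow_dist_mul_le hT hs0 hH x u)
      rw [mul_comm]
      exact mul_le_mul_of_nonneg_left hAx (pow_pos hs0 _).le
  obtain ⟨c, hc⟩ := hmin g hgE hg0 hgf
  have h1 := hc x
  have h2 := hc y
  rw [gxx] at h1
  rw [gyy] at h2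
  have h3 : A / s = c * f y := by linarith
  have h4 : A = s * (c * f y) := by rw [← h3]; field_simp
  -- If the factor is 0 then `A = 0`; otherwise comparing the values at `x` and `y` gives the other
  -- alternative.
  rcases eq_or_ne c 0 with rfl | hc0
  · left
    have h5 : (f y - s * f x) / (1 / s - s) = 0 := by rw [← hA, h1, zero_mul]
    rcases div_eq_zero_iff.1 h5 with h | h
    · linarith
    · exact absurd h hd.ne'
  · right
    have h5 : c * f x = c * (s * f y) := by rw [← h1, h4]; ring
    exact mul_left_cancel₀ hc0 h5

/-- Every vertex has exactly one neighbour in the direction of which a minimal positive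
eigenfunction increases. -/
theorem IsEigen.exists_parent {q : ℕ} (hreg : G.IsRegularOfDegree (q + 1)) {t s : ℝ} {f : V → ℝ}
    (hf : IsEigen G t f) (hpos : ∀ x, 0 < f x) (hs0 : 0 < s) (hs1 : s < 1)
    (ht : t = 1 / s + q * s)
    (hor : ∀ x y, G.Adj x y → f y = s * f x ∨ f x = s * f y) (x : V) :
    ∃ y, G.Adj x y ∧ f x = s * f y ∧ ∀ z, G.Adj x z → z ≠ y → f z = s * f x := by
  classical
  have hd : 0 < 1 / s - s := by
    have : 1 < 1 / s := by rw [lt_div_iff₀ hs0]; linarith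
    linarith
  set U := (G.neighborFinset x).filter fun y => f x = s * f y with hU
  -- Summing `f y - s * f x` over the neighbours gives `(1 / s - s) * f x`, exactly the contribution
  -- of one increasing neighbour; the others contribute 0.
  have hcard : U.card = 1 := by
    have h1 : ∀ y ∈ G.neighborFinset x,
        f y - s * f x = if f x = s * f y then (1 / s - s) * f x else 0 := by
      intro y hy
      rw [mem_neighborFinset] at hy
      split_ifs with h
      · have : f y = f x / s := by rw [h]; field_simp
        rw [this]; ring
      · rcases hor x y hy with h' | h'
        · rw [h']; ring
        · exact absurd h' h
    have h2 := Finset.sum_congr rfl h1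
    rw [Finset.sum_sub_distrib, hf x, ← Finset.sum_filter, ← hU, Finset.sum_const,
      Finset.sum_const, card_neighborFinset_eq_degree, hreg x, ht, nsmul_eq_mul,
      nsmul_eq_mul] at h2
    push_cast at h2
    have h3 : ((U.card : ℝ) - 1) * ((1 / s - s) * f x) = 0 := by linarith
    rcases mul_eq_zero.1 h3 with h | h
    · have : (U.card : ℝ) = 1 := by linarith
      exact_mod_cast this
    · exact absurd h (mul_pos hd (hpos x)).ne'
  obtain ⟨y, hy⟩ := Finset.card_eq_one.1 hcard
  have hyU : y ∈ U := by rw [hy]; simp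
  rw [hU, Finset.mem_filter, mem_neighborFinset] at hyU
  refine ⟨y, hyU.1, hyU.2, fun z hz hzy => ?_⟩
  rcases hor x z hz with h | h
  · exact h
  · have : z ∈ U := by rw [hU, Finset.mem_filter, mem_neighborFinset]; exact ⟨hz, h⟩
    rw [hy, Finset.mem_singleton] at this
    exact absurd this hzy

end DynamicGraph

namespace DynamicGraph

open SimpleGraph

variable {V : Type*} {G : SimpleGraph V} {v₀ : V}

/-! ### Transition probabilities of Markov measures. -/

section Markov

theorem FinPath.vert_injective (v : DynVertex G v₀) :
    Function.Injective (FinPath.vert : FinPath v → _) := by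
  rintro ⟨P, _, _, _⟩ ⟨P', _, _, _⟩ h
  cases h
  rfl

theorem FinPath.prod_snoc {a : DynVertex G v₀} (P : FinPath a) {y : V} (h : G.Adj a.proj y)
    (p : DynVertex G v₀ → DynVertex G v₀ → ℝ) :
    ∏ i : Fin (a.level + 1), p ((P.snoc h).vert i.castSucc) ((P.snoc h).vert i.succ) =
      (∏ i : Fin a.level, p (P.vert i.castSucc) (P.vert i.succ)) * p a (next a h) := by
  rw [Fin.prod_univ_castSucc]
  simp only [FinPath.snoc, Fin.snoc_castSucc, Fin.succ_last, Fin.snoc_last, Fin.succ_castSucc]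
  rw [P.finish]

theorem through_eq_iUnion (a : DynVertex G v₀) :
    through a = ⋃ P : FinPath a, cylinder P := by
  ext w
  rw [Set.mem_iUnion]
  constructor
  · intro hw
    have hw' : w.1 a.level = a := hw
    exact ⟨⟨fun i => w.1 i, w.2.1, fun i => w.2.2 i, hw'⟩, fun i => rfl⟩
  · rintro ⟨P, hP⟩
    exact cylinder_subset_through P hP

theorem disjoint_cylinder {a : DynVertex G v₀} {P P' : FinPath a} (h : P ≠ P') :
    Disjoint (cylinder P) (cylinder P') :=
  Set.disjoint_left.2 fun _ hw hw' =>
    h (FinPath.vert_injective a (funext fun i => (hw i).symm.trans (hw' i)))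

/-- The transition probabilities of a Markov measure. -/
theorem IsMarkovMeasure.transProb_eq [G.LocallyFinite] {ν : Measure (Paths G v₀)}
    {p : DynVertex G v₀ → DynVertex G v₀ → ℝ} (h : IsMarkovMeasure ν p) {a b : DynVertex G v₀}
    (hab : Succ a b) (hp : 0 ≤ p a b) (ha : ν (through a) ≠ 0) : transProb ν a b = p a b := by
  obtain ⟨hprob, hν⟩ := h
  have := countable_dynVertex (G := G) (v₀ := v₀)
  have hcount : Countable (FinPath a) := (FinPath.vert_injective a).countable
  have h1 : ∀ P : FinPath a, ν (cylinder P ∩ through b) =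
      ν (cylinder P) * ENNReal.ofReal (p a b) := by
    intro P
    have h2 : cylinder P ∩ through b = cylinder (P.snoc hab.adj) := by
      rw [cylinder_snoc]
      ext w
      refine and_congr_right fun _ => ?_
      rw [hab.eq_next]
      exact dynVertex_eq_iff w
    have h3 := hν _ (P.snoc hab.adj)
    rw [h2, ← ofReal_measureReal, h3]
    refine (congrArg ENNReal.ofReal (P.prod_snoc hab.adj p)).trans ?_
    rw [← hν a P, ← hab.eq_next, ENNReal.ofReal_mul measureReal_nonneg, ofReal_measureReal]
  have h2 : ν (through a ∩ through b) = ν (through a) * ENNReal.ofReal (p a b) := by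
    rw [through_eq_iUnion a, Set.iUnion_inter, measure_iUnion, measure_iUnion,
      ← ENNReal.tsum_mul_right]
    · exact tsum_congr h1
    · exact fun P P' hne => disjoint_cylinder hne
    · exact fun P => measurableSet_cylinder P
    · exact fun P P' hne => (disjoint_cylinder hne).mono Set.inter_subset_left
        Set.inter_subset_left
    · exact fun P => (measurableSet_cylinder P).inter (measurableSet_through b)
  rw [transProb, measureReal_def, cond_apply (measurableSet_through a), h2, ← mul_assoc,
    ENNReal.inv_mul_cancel ha (measure_ne_top _ _), one_mul, ENNReal.toReal_ofReal hp]

end Markov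

/-! ### Shifting time by two; the nondegenerate case. -/

section Shift

theorem prod_div_telescope {t : ℝ} (ht : t ≠ 0) (n : ℕ) (a : Fin (n + 1) → ℝ)
    (ha : ∀ i, a i ≠ 0) :
    ∏ i : Fin n, a i.succ / (t * a i.castSucc) = a (Fin.last n) / (t ^ n * a 0) := by
  induction n with
  | zero => simp [ha]
  | succ n ih =>
    rw [Fin.prod_univ_castSucc]
    have h1 := ih (fun i => a i.castSucc) fun i => ha _
    simp only [← Fin.succ_castSucc] at h1
    rw [h1, Fin.castSucc_zero, Fin.succ_last]
    have h2 := ha (Fin.last n).castSucc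
    have h3 := ha 0
    field_simp
    ring

/-- A tree is bipartite, so walks with the same ends have lengths of the same parity. -/
theorem Reach.exists_dist_add (hT : G.IsTree) {n : ℕ} {x : V} (hx : Reach G v₀ n x) :
    ∃ k, n = G.dist v₀ x + 2 * k := by
  obtain ⟨p, rfl⟩ := hx
  have h1 := hT.walk_length_mod_two p
  have h2 := SimpleGraph.dist_le p
  exact ⟨(p.length - G.dist v₀ x) / 2, by omega⟩

variable [G.LocallyFinite] {ν : Measure (Paths G v₀)}

theorem exists_adj_of_regular {q : ℕ} (hreg : G.IsRegularOfDegree (q + 1)) (x : V) :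
    ∃ y, G.Adj x y := by
  have : 0 < G.degree x := by rw [hreg x]; omega
  exact (G.degree_pos_iff_exists_adj x).1 this

theorem IsDynHarmonic.le_of_adj {h : ℕ → V → ℝ} (hh : IsDynHarmonic G v₀ h)
    (h0 : ∀ n x, 0 ≤ h n x) {n : ℕ} {x y : V} (hx : Reach G v₀ n x) (hxy : G.Adj x y) :
    h (n + 1) y ≤ h n x := by
  rw [hh n x hx]
  exact Finset.single_le_sum (f := fun y => h (n + 1) y) (fun z _ => h0 _ z) (by simpa using hxy)

/-- The harmonic function of an ergodic central measure is homogeneous in time. -/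
theorem IsErgodicCentral.cylinderValue_add_two {q : ℕ} (hreg : G.IsRegularOfDegree (q + 1))
    (hν : IsErgodicCentral ν) {n : ℕ} {x : V} (hx : Reach G v₀ n x) :
    cylinderValue ν (n + 2) x = cylinderValue ν 2 v₀ * cylinderValue ν n x := by
  have := hν.1.1
  have hh := hν.1.2.isDynHarmonic
  have h0 := cylinderValue_nonneg ν
  -- Domination comes from extending a path by a step to a neighbour and back, which can only
  -- decrease the measure.
  refine hν.eq_mul (g := fun n x => cylinderValue ν (n + 2) x) ?_ (fun n x _ => h0 _ x) ?_ hx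
  · intro n x hx
    obtain ⟨y, hxy⟩ := exists_adj_of_regular hreg x
    exact hh (n + 2) x (hx.add_two hxy)
  · intro n x hx
    obtain ⟨y, hxy⟩ := exists_adj_of_regular hreg x
    exact (hh.le_of_adj h0 (hx.succ hxy) hxy.symm).trans (hh.le_of_adj h0 hx hxy)

theorem reach_dist_add {q : ℕ} (hT : G.IsTree) (hreg : G.IsRegularOfDegree (q + 1)) (x : V)
    (k : ℕ) : Reach G v₀ (G.dist v₀ x + 2 * k) x := by
  induction k with
  | zero => exact hT.connected.exists_walk_length_eq_dist v₀ x
  | succ k ih =>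
    obtain ⟨y, hxy⟩ := exists_adj_of_regular hreg x
    exact ih.add_two hxy

/-- An ergodic central measure that can return to the starting point is a nondegenerate
`λ_{ω,r}`. -/
theorem IsErgodicCentral.exists_isLambda_of_pos {q : ℕ} (hq : 2 ≤ q) (hT : G.IsTree)
    (hreg : G.IsRegularOfDegree (q + 1)) (hν : IsErgodicCentral ν)
    (hc : 0 < cylinderValue ν 2 v₀) :
    ∃ (ω : G.end) (r : ℝ), r ∈ Set.Icc (0 : ℝ) 1 ∧ IsLambda q ω r ν ∧ IsNondegenerate ν := by
  have hprob := hν.1.1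
  have hcen := hν.1.2
  have hh := hcen.isDynHarmonic
  have h0 := cylinderValue_nonneg ν
  have hroot := cylinderValue_root hcen
  set c := cylinderValue ν 2 v₀ with hcdef
  -- Two levels multiply the harmonic function by `c`, so the weight `t ^ n` removes its dependence
  -- on the level.
  obtain ⟨t, ht⟩ : ∃ t, t = (√c)⁻¹ := ⟨_, rfl⟩
  have ht0 : 0 < t := by rw [ht]; exact inv_pos.2 (Real.sqrt_pos.2 hc)
  have htc : t ^ 2 * c = 1 := by
    rw [ht, inv_pow, Real.sq_sqrt hc.le, inv_mul_cancel₀ hc.ne']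
  obtain ⟨f, hfdef⟩ : ∃ f : V → ℝ, ∀ x, f x = t ^ G.dist v₀ x * cylinderValue ν (G.dist v₀ x) x :=
    ⟨_, fun _ => rfl⟩
  have hform : ∀ n x, Reach G v₀ n x → t ^ n * cylinderValue ν n x = f x := by
    intro n x hx
    obtain ⟨k, rfl⟩ := hx.exists_dist_add hT
    clear hx
    induction k with
    | zero => rw [hfdef]; rfl
    | succ k ih =>
      have h1 := hν.cylinderValue_add_two hreg (reach_dist_add (v₀ := v₀) hT hreg x k)
      rw [Nat.mul_succ, ← add_assoc, h1, ← ih, ← hcdef, pow_add]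
      linear_combination (t ^ (G.dist v₀ x + 2 * k) *
        cylinderValue ν (G.dist v₀ x + 2 * k) x) * htc
  have hreach : ∀ x, Reach G v₀ (G.dist v₀ x) x := fun x => reach_dist_add hT hreg x 0
  have hf : IsEigen G t f := by
    intro x
    rw [← hform _ x (hreach x), hh _ _ (hreach x), Finset.mul_sum, Finset.mul_sum]
    refine Finset.sum_congr rfl fun y hy => ?_
    rw [← hform _ y ((hreach x).succ (by simpa using hy)), pow_succ]
    ring
  have hf0 : ∀ x, 0 ≤ f x := fun x => by
    rw [hfdef]; exact mul_nonneg (pow_pos ht0 _).le (h0 _ _)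
  have hfv : f v₀ = 1 := by rw [hfdef]; simp [hroot]
  have hpos : ∀ x, 0 < f x := by
    intro x
    refine (hf0 x).lt_of_ne' fun hx => ?_
    have key : ∀ {u w : V}, G.Walk u w → f u = 0 → f w = 0 := by
      intro u w p
      induction p with
      | nil => exact id
      | cons h p ih =>
        rename_i u v w
        intro hu
        have h1 := hf u
        rw [hu, mul_zero, Finset.sum_eq_zero_iff_of_nonneg fun z _ => hf0 z] at h1
        exact ih (h1 v (by simpa using h))
    obtain ⟨p⟩ := hT.connected x v₀
    have := key p hx
    rw [hfv] at this
    exact one_ne_zero this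
  have hmin : ∀ g : V → ℝ, IsEigen G t g → (∀ x, 0 ≤ g x) → (∀ x, g x ≤ f x) →
      ∃ c, ∀ x, g x = c * f x := by
    intro g hg hg0 hgf
    refine ⟨g v₀, fun x => ?_⟩
    -- Undoing the weight turns an eigenfunction below `f` into a harmonic function below that of
    -- `ν`.
    have h1 := hν.eq_mul (g := fun n x => (t ^ n)⁻¹ * g x) (fun n x hx => ?_)
      (fun n x hx => mul_nonneg (inv_pos.2 (pow_pos ht0 n)).le (hg0 x)) (fun n x hx => ?_)
      (hreach x)
    · simp only [pow_zero, inv_one, one_mul] at h1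
      have h2 : t ^ G.dist v₀ x ≠ 0 := (pow_pos ht0 _).ne'
      rw [hfdef x, mul_left_comm, ← h1]
      field_simp
    · rw [← Finset.mul_sum, hg x, pow_succ]
      field_simp
    · rw [inv_mul_le_iff₀ (pow_pos ht0 n), hform n x hx]
      exact hgf x
  have hne : Nonempty V := ⟨v₀⟩
  obtain ⟨s, hs0, hs1, hts, hH⟩ := hf.exists_harnack hq hreg hpos
  have hor := fun x y hxy =>
    hf.eq_or_eq_of_minimal hT hreg hs0 hs1 hts hH hmin (x := x) (y := y) hxy
  choose σ hσ hfσ hother using hf.exists_parent hreg hpos hs0 hs1 hts hor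
  obtain ⟨ω, hω⟩ := exists_end_of_parent hT hpos hs0 hs1 hσ hfσ hother
  have hq0 : (0 : ℝ) < q := by exact_mod_cast (by omega : 0 < q)
  have hst : s * t = 1 + q * s ^ 2 := by rw [hts]; field_simp
  have hst1 : 1 ≤ s * t := by rw [hst]; nlinarith [sq_nonneg s]
  -- The transition probability `f y / (t * f x)` is `1 / (s * t)` towards `ω` and `s / t`
  -- otherwise; the latter is `(1 - r) / q` because `s * t = 1 + q * s ^ 2`.
  refine ⟨ω, 1 / (s * t), ⟨by positivity, ?_⟩, ⟨hprob, fun v P => ?_⟩, fun v P => ?_⟩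
  · rw [div_le_one (by linarith)]
    exact hst1
  · have h1 : ∀ i : Fin v.level,
        lambdaProb q ω (1 / (s * t)) (P.vert i.castSucc) (P.vert i.succ) =
          f (P.vert i.succ).proj / (t * f (P.vert i.castSucc).proj) := by
      intro i
      have hstep := P.step i
      have h2 := hω _ _ hstep.adj
      rw [lambdaProb]
      split_ifs with hd
      · rw [h2.1 hd.2, hfσ (P.vert i.castSucc).proj]
        have := (hpos (σ (P.vert i.castSucc).proj)).ne'
        field_simp
      · have h3 := hother _ _ hstep.adj fun h => hd ⟨hstep, h2.2 h⟩
        rw [h3]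
        have h4 := (hpos (P.vert i.castSucc).proj).ne'
        have h5 : s * t ≠ 0 := by positivity
        have h6 : 1 - 1 / (s * t) = q * s ^ 2 / (s * t) := by
          field_simp
          linarith
        rw [h6]
        field_simp
    rw [Finset.prod_congr rfl fun i _ => h1 i,
      prod_div_telescope ht0.ne' v.level (fun i => f (P.vert i).proj) fun i => (hpos _).ne',
      hcen.real_cylinder, P.finish, P.start, ← hform v.level v.proj v.reachable]
    have h2 : f (root G v₀).proj = 1 := hfv
    rw [h2]
    have h3 := (pow_pos ht0 v.level).ne'
    field_simp
  · intro h
    have h1 := hcen.real_cylinder P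
    rw [measureReal_def, h, ENNReal.toReal_zero] at h1
    have h2 := hform v.level v.proj v.reachable
    rw [← h1, mul_zero] at h2
    exact (hpos _).ne h2

end Shift

/-! ### The degenerate case. -/

section Degenerate

variable {ν : Measure (Paths G v₀)}

/-- Distance from `v₀` never exceeds the level, so, read backwards from `v`, each step must approach
`v₀`; in a tree that step is unique. -/
theorem FinPath.eq_of_level_eq_dist (hT : G.IsTree) {v : DynVertex G v₀}
    (hv : v.level = G.dist v₀ v.proj) (P P' : FinPath v) : P = P' := by
  refine FinPath.vert_injective v (funext fun i => ?_)
  suffices h : P.vert i = P'.vert i ∧ G.dist (P.vert i).proj v₀ = i from h.1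
  induction i using Fin.reverseInduction with
  | last =>
    rw [P.finish, P'.finish, SimpleGraph.dist_comm, ← hv]
    exact ⟨rfl, rfl⟩
  | cast i ih =>
    obtain ⟨ih1, ih2⟩ := ih
    have hle : ∀ (Q : FinPath v), G.dist (Q.vert i.castSucc).proj v₀ ≤ i := by
      intro Q
      obtain ⟨p, hp⟩ := (Q.vert i.castSucc).reachable
      have h1 := SimpleGraph.dist_le p
      have h2 := Q.level_vert i.castSucc
      rw [SimpleGraph.dist_comm]
      rw [Fin.val_castSucc] at h2
      omega
    have h1 := hT.dist_adj_cases v₀ (P.step i).adj.symm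
    have h2 := hT.dist_adj_cases v₀ (P'.step i).adj.symm
    have h3 := hle P
    have h4 := hle P'
    rw [← ih1] at h2
    rw [Fin.val_succ] at ih2
    refine ⟨DynVertex.ext ?_ ?_, ?_⟩
    · rw [P.level_vert, P'.level_vert]
    · exact hT.eq_of_adj_of_dist_add_one (u := (P.vert i.succ).proj) (x := v₀)
        (P.step i).adj.symm (ih1 ▸ (P'.step i).adj.symm) (by omega) (by omega)
    · rw [Fin.val_castSucc]
      omega

/-- Otherwise `ν` is a proper mixture of its conditionings on `A` and on the complement, both
central by `hcen`; extremality equates `ν` with the first, which does not charge the complement. -/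
theorem measure_eq_zero_or_compl_of_extreme
    (hν : IsErgodicCentral ν)
    (hcen : ∀ μ : Measure (Paths G v₀), IsProbabilityMeasure μ → μ ≪ ν → IsCentral μ)
    {A : Set (Paths G v₀)} (hA : MeasurableSet A) : ν A = 0 ∨ ν Aᶜ = 0 := by
  obtain ⟨⟨hprob, -⟩, hext⟩ := hν
  by_contra! h
  obtain ⟨h1, h2⟩ := h
  have hmem : ∀ B : Set (Paths G v₀), ν B ≠ 0 → cond ν B ∈ centralMeasures G v₀ := fun B hB =>
    ⟨cond_isProbabilityMeasure hB, hcen _ (cond_isProbabilityMeasure hB) cond_absolutelyContinuous⟩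
  have hsmul : ∀ B : Set (Paths G v₀), ν B ≠ 0 →
      (ν B).toNNReal • cond ν B = ν.restrict B := by
    intro B hB
    have h3 : (ν B).toNNReal • cond ν B = ((ν B).toNNReal : ℝ≥0∞) • cond ν B := rfl
    rw [h3, ENNReal.coe_toNNReal (measure_ne_top _ _), ProbabilityTheory.cond, smul_smul,
      ENNReal.mul_inv_cancel hB (measure_ne_top _ _), one_smul]
  have hseg : ν ∈ openSegment ℝ≥0 (cond ν A) (cond ν Aᶜ) := by
    refine ⟨(ν A).toNNReal, (ν Aᶜ).toNNReal, ?_, ?_, ?_, ?_⟩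
    · exact ENNReal.toNNReal_pos h1 (measure_ne_top _ _)
    · exact ENNReal.toNNReal_pos h2 (measure_ne_top _ _)
    · rw [← ENNReal.toNNReal_add (measure_ne_top _ _) (measure_ne_top _ _),
        measure_add_measure_compl hA, measure_univ, ENNReal.toNNReal_one]
    · rw [hsmul A h1, hsmul _ h2, Measure.restrict_add_restrict_compl hA]
  have heq := hext (hmem A h1) (hmem _ h2) hseg
  refine h2 ?_
  rw [← heq, cond_apply hA, Set.inter_compl_self, measure_empty, mul_zero]

variable [G.LocallyFinite]

theorem IsErgodicCentral.level_eq_dist {q : ℕ} (hT : G.IsTree)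
    (hreg : G.IsRegularOfDegree (q + 1)) (hν : IsErgodicCentral ν)
    (hc : cylinderValue ν 2 v₀ = 0) {n : ℕ} {x : V} (hx : Reach G v₀ n x)
    (hne : cylinderValue ν n x ≠ 0) : n = G.dist v₀ x := by
  obtain ⟨k, rfl⟩ := hx.exists_dist_add hT
  cases k with
  | zero => rfl
  | succ k =>
    have h1 := hν.cylinderValue_add_two hreg (reach_dist_add (v₀ := v₀) hT hreg x k)
    rw [hc, zero_mul] at h1
    exact absurd h1 hne

/-- Each coordinate takes countably many values, so by the zero-one law it is almost surely
constant. -/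
theorem exists_eq_dirac [IsProbabilityMeasure ν]
    (h01 : ∀ A : Set (Paths G v₀), MeasurableSet A → ν A = 0 ∨ ν Aᶜ = 0) :
    ∃ w, ν = Measure.dirac w := by
  have hcount := countable_dynVertex (G := G) (v₀ := v₀)
  have h1 : ∀ n, ∃ a : DynVertex G v₀, ∀ᵐ w ∂ν, w.1 n = a := by
    intro n
    by_contra hno
    rw [not_exists] at hno
    have h2 : ∀ a : DynVertex G v₀, ν {w | w.1 n = a} = 0 := fun a =>
      (h01 _ (measurableSet_coord n {a})).resolve_right fun h => hno a (mem_ae_iff.2 h)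
    have h3 : (⋃ a : DynVertex G v₀, {w : Paths G v₀ | w.1 n = a}) = Set.univ :=
      Set.eq_univ_of_forall fun w => Set.mem_iUnion.2 ⟨w.1 n, rfl⟩
    have h4 := measure_iUnion_null h2
    rw [h3, measure_univ] at h4
    exact one_ne_zero h4
  choose a ha using h1
  have h2 : ∀ᵐ w ∂ν, ∀ n, w.1 n = a n := ae_all_iff.2 ha
  obtain ⟨w, hw⟩ := h2.exists
  refine ⟨w, Measure.ext fun s hs => ?_⟩
  have h3 : ∀ᵐ w' ∂ν, w' = w := h2.mono fun w' hw' =>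
    Subtype.ext (funext fun n => (hw' n).trans (hw n).symm)
  rw [Measure.dirac_apply' w hs]
  by_cases hws : w ∈ s
  · rw [Set.indicator_of_mem hws, Pi.one_apply, ← measure_univ (μ := ν)]
    refine measure_congr (h3.mono fun w' hw' => ?_)
    rw [hw']
    exact eq_true hws
  · rw [Set.indicator_of_notMem hws, ← measure_empty (μ := ν)]
    refine measure_congr (h3.mono fun w' hw' => ?_)
    rw [hw']
    exact eq_false hws

/-- An ergodic central measure that cannot return to the starting point is a Dirac measure. -/
theorem IsErgodicCentral.exists_isLambda_of_eq_zero {q : ℕ} (hT : G.IsTree)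
    (hreg : G.IsRegularOfDegree (q + 1)) (hν : IsErgodicCentral ν)
    (hc : cylinderValue ν 2 v₀ = 0) :
    ∃ ω : G.end, IsLambda q ω 1 ν ∧ ∃ w : Paths G v₀,
      IsGeodesicRay (G := G) (fun n => (w.1 n).proj) ∧
      TendsToEnd ω (fun n => (w.1 n).proj) ∧ ν = Measure.dirac w := by
  have hprob := hν.1.1
  have hcen := hν.1.2
  have hdist := fun n x => hν.level_eq_dist hT hreg hc (n := n) (x := x)
  -- Endpoints not charged by `ν` are not charged by `μ`; charged ones are reached by a single path.
  have hac : ∀ μ : Measure (Paths G v₀), IsProbabilityMeasure μ → μ ≪ ν → IsCentral μ := by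
    intro μ hμ hμν
    refine (isCentral_iff μ).2 fun v P P' => ?_
    by_cases hv : cylinderValue ν v.level v.proj = 0
    · have h1 : ∀ Q : FinPath v, μ.real (cylinder Q) = 0 := by
        intro Q
        have h2 := hcen.real_cylinder Q
        rw [hv, measureReal_eq_zero_iff] at h2
        rw [measureReal_eq_zero_iff]
        exact hμν h2
      rw [h1, h1]
    · rw [FinPath.eq_of_level_eq_dist hT (hdist _ _ v.reachable hv) P P']
  obtain ⟨w, hw⟩ := exists_eq_dirac fun A hA => measure_eq_zero_or_compl_of_extreme hν hac hA
  have hreal : ∀ {v : DynVertex G v₀} (P : FinPath v), w ∈ cylinder P →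
      ν.real (cylinder P) = 1 := by
    intro v P hP
    rw [hw, measureReal_def, Measure.dirac_apply_of_mem hP, ENNReal.toReal_one]
  have hreal' : ∀ {v : DynVertex G v₀} (P : FinPath v), w ∉ cylinder P →
      ν.real (cylinder P) = 0 := by
    intro v P hP
    rw [hw, measureReal_def, Measure.dirac_apply' _ (measurableSet_cylinder P),
      Set.indicator_of_notMem hP, ENNReal.toReal_zero]
  have hwd : ∀ n, G.dist v₀ (w.1 n).proj = n := by
    intro n
    have h1 := hcen.real_cylinder (FinPath.ofPath w n)
    rw [hreal _ fun i => rfl, level_path] at h1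
    exact (hdist n _ (reach_path w n) (by rw [← h1]; exact one_ne_zero)).symm
  have hgeo : IsGeodesicRay (G := G) fun n => (w.1 n).proj := by
    intro m k
    refine ⟨hT.connected _ _, le_antisymm ?_ ?_⟩
    · induction k with
      | zero => simp
      | succ k ih =>
        refine (hT.connected.dist_triangle (v := (w.1 (m + k)).proj)).trans ?_
        have : G.dist (w.1 (m + k)).proj (w.1 (m + (k + 1))).proj = 1 :=
          SimpleGraph.dist_eq_one_iff_adj.2 (adj_path w (m + k))
        exact (add_le_add ih this.le).trans_eq rfl
    · have h1 := hT.connected.dist_triangle (u := v₀) (v := (w.1 m).proj)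
        (w := (w.1 (m + k)).proj)
      rw [hwd, hwd] at h1
      exact Nat.le_of_add_le_add_left h1
  obtain ⟨ω, hω⟩ := hgeo.exists_end
  have hlies : ∀ n y, G.Adj (w.1 n).proj y →
      (LiesBetween ω (w.1 n).proj y ↔ y = (w.1 (n + 1)).proj) := by
    intro n y hy
    refine liesBetween_iff_of_adj hT (γ := fun k => (w.1 (n + k)).proj) ?_ ?_ hy
    · intro m k
      have := hgeo (n + m) k
      rwa [add_assoc] at this
    · intro K
      have := (tendsto_add_atTop_nat n).eventually (hω K)
      simpa only [add_comm] using this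
  refine ⟨ω, ⟨hprob, fun v P => ?_⟩, w, hgeo, hω, hw⟩
  by_cases hP : w ∈ cylinder P
  · rw [hreal P hP, eq_comm]
    refine Finset.prod_eq_one fun i _ => ?_
    have hd : IsDirected ω (P.vert i.castSucc) (P.vert i.succ) := by
      refine ⟨P.step i, ?_⟩
      have h1 := hP i.castSucc
      have h2 := hP i.succ
      rw [← h1, ← h2]
      exact (hlies i _ (adj_path w i)).2 rfl
    rw [lambdaProb, if_pos hd]
  -- With `r = 1` an undirected edge has probability 0, so a nonzero product would force the path to
  -- follow `w`.
  · rw [hreal' P hP, eq_comm]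
    by_contra hprod
    refine hP fun i => ?_
    replace hprod := Finset.prod_ne_zero_iff.1 hprod
    induction i using Fin.induction with
    | zero => rw [P.start]; exact w.2.1
    | succ i ih =>
      have h1 := hprod i (Finset.mem_univ i)
      rw [lambdaProb, sub_self, zero_div] at h1
      have hd : IsDirected ω (P.vert i.castSucc) (P.vert i.succ) := by
        by_contra hd
        exact h1 (if_neg hd)
      have h2 := hd.1
      have h3 := hd.2
      rw [← ih] at h2 h3
      have h4 := (hlies i _ h2.adj).1 h3
      refine DynVertex.ext ?_ h4.symm
      rw [level_path, P.level_vert]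

end Degenerate

end DynamicGraph

/-! ### The main theorem. -/

theorem proposition1 {V : Type*} (G : SimpleGraph V) [G.LocallyFinite] (q : ℕ) (hq : 2 ≤ q)
    (hT : G.IsTree) (hreg : G.IsRegularOfDegree (q + 1)) (v₀ : V)
    (ν : Measure (DynamicGraph.Paths G v₀)) (hν : DynamicGraph.IsErgodicCentral ν) :
    ∃ (ω : G.end) (r : ℝ), r ∈ Set.Icc (0 : ℝ) 1 ∧
      DynamicGraph.IsLambda q ω r ν ∧
      (∀ a b : DynVertex G v₀, DynamicGraph.Succ a b → ν (DynamicGraph.through a) ≠ 0 →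
        (DynamicGraph.IsDirected ω a b → DynamicGraph.transProb ν a b = r) ∧
        (¬ DynamicGraph.IsDirected ω a b → DynamicGraph.transProb ν a b = (1 - r) / q)) ∧
      DynamicGraph.IsTimeHomogeneous ν ∧
      (¬ DynamicGraph.IsNondegenerate ν →
        r = 1 ∧ ∃ w : DynamicGraph.Paths G v₀,
          DynamicGraph.IsGeodesicRay (G := G) (fun n => (w.1 n).proj) ∧
          DynamicGraph.TendsToEnd ω (fun n => (w.1 n).proj) ∧
          ν = Measure.dirac w) := by
  obtain ⟨ω, r, hr, hlam, hdeg⟩ : ∃ (ω : G.end) (r : ℝ), r ∈ Set.Icc (0 : ℝ) 1 ∧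
      DynamicGraph.IsLambda q ω r ν ∧
      (¬ DynamicGraph.IsNondegenerate ν →
        r = 1 ∧ ∃ w : DynamicGraph.Paths G v₀,
          DynamicGraph.IsGeodesicRay (G := G) (fun n => (w.1 n).proj) ∧
          DynamicGraph.TendsToEnd ω (fun n => (w.1 n).proj) ∧
          ν = Measure.dirac w) := by
    rcases (DynamicGraph.cylinderValue_nonneg ν 2 v₀).eq_or_lt with hc | hc
    · obtain ⟨ω, hlam, hw⟩ := hν.exists_isLambda_of_eq_zero hT hreg hc.symm
      exact ⟨ω, 1, ⟨zero_le_one, le_rfl⟩, hlam, fun _ => ⟨rfl, hw⟩⟩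
    · obtain ⟨ω, r, hr, hlam, hnd⟩ := hν.exists_isLambda_of_pos hq hT hreg hc
      exact ⟨ω, r, hr, hlam, fun h => absurd hnd h⟩
  have htrans : ∀ a b : DynVertex G v₀, DynamicGraph.Succ a b →
      ν (DynamicGraph.through a) ≠ 0 →
      DynamicGraph.transProb ν a b = DynamicGraph.lambdaProb q ω r a b := by
    intro a b hab ha
    refine hlam.transProb_eq hab ?_ ha
    rw [DynamicGraph.lambdaProb]
    split_ifs
    · exact hr.1
    · exact div_nonneg (sub_nonneg.2 hr.2) (Nat.cast_nonneg q)
  refine ⟨ω, r, hr, hlam, fun a b hab ha => ⟨fun hd => ?_, fun hd => ?_⟩, ?_, hdeg⟩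
  · rw [htrans a b hab ha, DynamicGraph.lambdaProb, if_pos hd]
  · rw [htrans a b hab ha, DynamicGraph.lambdaProb, if_neg hd]
  · intro a b a' b' hab hab' haa hbb ha ha'
    rw [htrans a b hab ha, htrans a' b' hab' ha', DynamicGraph.lambdaProb,
      DynamicGraph.lambdaProb]
    have hiff : DynamicGraph.IsDirected ω a b ↔ DynamicGraph.IsDirected ω a' b' := by
      rw [DynamicGraph.IsDirected, DynamicGraph.IsDirected, haa, hbb]
      exact and_congr_left fun _ => ⟨fun _ => hab', fun _ => hab⟩
    by_cases hd : DynamicGraph.IsDirected ω a b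
    · rw [if_pos hd, if_pos (hiff.1 hd)]
    · rw [if_neg hd, if_neg fun h => hd (hiff.2 h)]
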